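/- Let $\Omega\subset\mathbb R^2$ be a nonempty, bounded, open convex set such that either $\partial\Omega$ is a simple closed $C^2$ curve (with a regular, i.e. arc-length, $C^2$ parametrization) or $\Omega$ is a convex polygon. Let $\mathbf n$ be the outer unit normal on $\partial\Omega$ (at the finitely many vertices of a polygon it may be any outer unit normal of a supporting line). For $\delta>0$, with $B_\delta(x)$ the open disc, put $$\Omega^-_{(\delta)}=\{x\in\Omega: B_\delta(x)\subset\Omega\},\quad \Omega^{-}_{\gamma,\delta}=\Omega\setminus\overline{\Omega^-_{(\delta)}},\quad \Omega^+_{(\delta)}=\mathbb R^2\setminus\overline{\{x: B_\delta(x)\cap\Omega=\emptyset\}},\quad \Omega^{+}_{\gamma,\delta}=\Omega^+_{(\delta)}\setminus\overline\Omega .$$ A kernel with horizon $\delta>0$ and second moment $\sigma$ is a nonnegative function $\gamma_\delta(x,y)=\widetilde\gamma_\delta(|x-y|)$ on $\mathbb R^2\times\mathbb R^2$ with $\widetilde\gamma_\delta\in L^1(0,\delta)$, $\gamma_\delta(x,y)=0$ for $|x-y|>\delta$, and $\tfrac12\int_{\mathbb R^2}x\otimes x\,\widetilde\gamma_\delta(|x|)\,dx=\sigma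 I$. The outer nonlocal Neumann operator is $$\mathcal N^*_\Omega u(x)=\int_{\Omega^+_{(\delta)}}[u(x)-u(y)]\,\gamma_\delta(x,y)\,dy,\qquad x\in\Omega^+_{\gamma,\delta}.$$ Let $\delta_0>0$, and let $u$ and $v$ be real functions on $\mathbb R^2$ whose restrictions to the open neighbourhood $\Omega^-_{\gamma,\delta_0}\cup\partial\Omega\cup\Omega^+_{\gamma,\delta_0}$ of $\partial\Omega$ are of class $C^2$ and $C^1$ respectively. Let $\sigma\in\mathbb R$. Then $$\int_{\Omega^+_{\gamma,\delta}}\mathcal N^*_\Omega u(x)\,v(x)\,dx=\int_{\partial\Omega}\sigma\,\partial_{\mathbf n}u\;v\,ds+\mathcal O(\delta)\qquad(\delta\to0^+);$$ precisely, there are $C$ and $\delta_1>0$, depending only on $\Omega,u,v,\sigma$ (and $\delta_0$), such that for every $0<\delta<\delta_1$ and every kernel with horizon $\delta$ and second moment $\sigma$ the difference of the two integrals is at most $C\delta$ in absolute value. -/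

import Mathlib

open MeasureTheory

namespace NonlocalNeumann

/-- The Euclidean plane. -/
abbrev Plane : Type := EuclideanSpace ℝ (Fin 2)

/-- `Ω⁻ = {x ∈ Ω : B_δ(x) ⊂ Ω}`. -/
def innerPart (Ω : Set Plane) (δ : ℝ) : Set Plane :=
  {x | x ∈ Ω ∧ Metric.ball x δ ⊆ Ω}

/-- The inner layer `Ω_γ⁻ = Ω \ closure Ω⁻`. -/
def innerLayer (Ω : Set Plane) (δ : ℝ) : Set Plane :=
  Ω \ closure (innerPart Ω δ)

/-- `Ω⁺ = ℝ² \ closure {x : B_δ(x) ∩ Ω = ∅}`. -/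
def outerPart (Ω : Set Plane) (δ : ℝ) : Set Plane :=
  (closure {x | Metric.ball x δ ∩ Ω = ∅})ᶜ

/-- The outer layer `Ω_γ⁺ = Ω⁺ \ closure Ω`. -/
def outerLayer (Ω : Set Plane) (δ : ℝ) : Set Plane :=
  outerPart Ω δ \ closure Ω

/-- The full two-sided layer around the boundary: `Ω_γ⁻ ∪ ∂Ω ∪ Ω_γ⁺`. -/
def boundaryLayer (Ω : Set Plane) (δ : ℝ) : Set Plane :=
  innerLayer Ω δ ∪ frontier Ω ∪ outerLayer Ω δ

/-- `γ` is a kernel with horizon `δ` whose second moment matrix is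
`½ ∫ x ⊗ x γ(|x|) dx = σ I`. -/
structure IsKernel (δ σ : ℝ) (γ : Plane → Plane → ℝ) : Prop where
  pos : 0 < δ
  radial : ∃ g : ℝ → ℝ, IntegrableOn g (Set.Ioo 0 δ) ∧ ∀ x y, γ x y = g ‖x - y‖
  nonneg : ∀ x y, 0 ≤ γ x y
  support : ∀ x y, δ < ‖x - y‖ → γ x y = 0
  moment : ∀ i j : Fin 2,
    (1 / 2 : ℝ) * ∫ x : Plane, x i * x j * γ x 0 = if i = j then σ else 0

/-- The outer nonlocal Neumann operator
`N_Ω^* u (x) = ∫_{y ∈ Ω⁺} [u(x) - u(y)] γ(x, y) dy`. -/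
noncomputable def outerNeumann (Ω : Set Plane) (δ : ℝ) (γ : Plane → Plane → ℝ)
    (u : Plane → ℝ) (x : Plane) : ℝ :=
  ∫ y in outerPart Ω δ, (u x - u y) * γ x y

/-- The boundary of `Ω` is a simple closed `C²` curve, parametrized by arc length. -/
def HasC2Boundary (Ω : Set Plane) : Prop :=
  ∃ (L : ℝ) (c : ℝ → Plane), 0 < L ∧ ContDiff ℝ 2 c ∧ (∀ s, c (s + L) = c s) ∧
    (∀ s, ‖deriv c s‖ = 1) ∧ Set.InjOn c (Set.Ico 0 L) ∧ c '' Set.Ico 0 L = frontier Ω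

/-- An (open) convex polygon: a nonempty bounded intersection of finitely many
open half-planes. -/
def IsConvexPolygon (Ω : Set Plane) : Prop :=
  Ω.Nonempty ∧ Bornology.IsBounded Ω ∧
    ∃ (m : ℕ) (a : Fin m → Plane) (b : Fin m → ℝ), (∀ i, a i ≠ 0) ∧
      Ω = {x | ∀ i, inner ℝ (a i) x < b i}

/-- `n` is an outer unit normal of the convex set `Ω` at the boundary point `p`.
It is unique wherever the boundary has a tangent line, that is, everywhere when the
boundary is `C²`, and everywhere except at the vertices when `Ω` is a polygon. -/
def IsOuterUnitNormal (Ω : Set Plane) (p n : Plane) : Prop :=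
  ‖n‖ = 1 ∧ ∀ x ∈ Ω, inner ℝ n (x - p) ≤ 0

/-- `⟨∂_n u, v⟩_{∂Ω}`, the integral being taken with respect to arc length
(one-dimensional Hausdorff measure) and `n` being the outer unit normal field. -/
noncomputable def boundaryPairing (Ω : Set Plane) (n : Plane → Plane) (u v : Plane → ℝ) : ℝ :=
  ∫ p in frontier Ω, fderiv ℝ u p (n p) * v p ∂(Measure.hausdorffMeasure 1 : Measure Plane)

end NonlocalNeumann

/-!
Writing `A` for the `δ`-neighbourhood of `Ω` and `k` for the convolution kernel, the outer part of
the plane is `A`, and Taylor expansion of `u` replaces `u x - u y` by `Du(x)(x - y)`. The remainder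
is controlled by the second moment `∫ |z|² k = 4σ`; as the outer layer has area `O(δ)`
(`exists_volume_thickening_diff_le`, by comparing `A` with a dilation of `Ω`), it contributes `O(δ)`.
At points of the closure of `Ω` the set `A` contains the whole support of the kernel, so the odd
first-order part integrates to zero there and the layer may be replaced by `A`. With `f = v • Du`
the remaining quantity is `∫_A ∫_A f(x)(x - y) k(x - y)`, and exchanging `x` and `y` turns it into
`½ ∫_A ∫_A (f(x) - f(y))(x - y) k(x - y)` (`two_mul_integral_eq`). No first moment of `k`, which is
not controlled by `δ` and `σ`, is left.

For a displacement `z`, writing `f(y + z) - f(y)` as an integral of `Df(y + t z) z` and translating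
the domain instead of differentiating once more, the increments amount to `∫_Ω Df(y) z z dy` up to
`O(|z|²)` times the area of the outer layer (`abs_integral_pairs_sub_le`). Isotropy of the second
moment then gives `σ ∫_Ω div f + O(δ)`, and the divergence theorem concludes.

The divergence theorem is proved on any bounded open convex set, with respect to the
one-dimensional Hausdorff measure (`integral_fderiv_eq_integral_frontier`). Along a direction `e`,
Fubini and the fundamental theorem of calculus leave an integral over the shadow of `Ω` on the
orthogonal line. It is compared with the boundary integral by an area formula
(`volume_image_inner_eq_lintegral`): where the normals `n` of two boundary points are close to each
other, the supporting half-planes force the chord to be nearly orthogonal to `n`, so that the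
projection along `e` scales lengths by nearly `⟪e, n⟫`. Measurability of `n` holds because slopes are
monotone along the boundary.

Finally `u` and `v` are multiplied by a cutoff function equal to `1` near the boundary; this changes
neither side for small `δ`.
-/

namespace NonlocalNeumann

open scoped Topology ENNReal Pointwise

/-! ### The outer parallel set of a convex set -/

theorem outerPart_eq_thickening {Ω : Set Plane} {δ : ℝ} :
    outerPart Ω δ = Metric.thickening δ Ω := by
  have h : {x : Plane | Metric.ball x δ ∩ Ω = ∅} = (Metric.thickening δ Ω)ᶜ := by
    ext x
    simp only [Set.mem_ofPred_eq, Set.mem_compl_iff, Metric.mem_thickening_iff,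
      Set.eq_empty_iff_forall_notMem, Set.mem_inter_iff, Metric.mem_ball, not_exists, not_and]
    refine forall_congr' fun z => ?_
    rw [dist_comm z x]
    tauto
  rw [outerPart, h, Metric.isOpen_thickening.isClosed_compl.closure_eq, compl_compl]

/-- A convex set containing a ball of radius `ρ` about `x₀` has its `δ`-neighbourhood inside its
dilation about `x₀` with ratio `1 + δ / ρ`, because `Ω + (δ / ρ) • (Ω - x₀)` is that dilation. -/
theorem thickening_subset_homothety {Ω : Set Plane} (hconv : Convex ℝ Ω) {x₀ : Plane} {ρ δ : ℝ}
    (hρ : 0 < ρ) (hδ : 0 < δ) (hball : Metric.ball x₀ ρ ⊆ Ω) :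
    Metric.thickening δ Ω ⊆ AffineMap.homothety x₀ (1 + δ / ρ) '' Ω := by
  intro x hx
  obtain ⟨y, hy, hxy⟩ := Metric.mem_thickening_iff.1 hx
  have hz : x₀ + (ρ / δ) • (x - y) ∈ Ω := by
    apply hball
    rw [dist_eq_norm] at hxy
    rw [Metric.mem_ball, dist_eq_norm, add_sub_cancel_left, norm_smul, Real.norm_eq_abs,
      abs_of_pos (by positivity)]
    calc ρ / δ * ‖x - y‖ < ρ / δ * δ := by gcongr
      _ = ρ := by field_simp
  have hne : ρ + δ ≠ 0 := by positivity
  refine ⟨(ρ / (ρ + δ)) • y + (δ / (ρ + δ)) • (x₀ + (ρ / δ) • (x - y)),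
    hconv hy hz (by positivity) (by positivity) (by field_simp), ?_⟩
  rw [AffineMap.homothety_apply, vsub_eq_sub, vadd_eq_add]
  match_scalars <;> field_simp <;> ring

/-- The outer layer of width `δ` has area `O(δ)`. -/
theorem exists_volume_thickening_diff_le {Ω : Set Plane} (hopen : IsOpen Ω) (hne : Ω.Nonempty)
    (hbdd : Bornology.IsBounded Ω) (hconv : Convex ℝ Ω) :
    ∃ C : ℝ, 0 ≤ C ∧ ∀ δ, 0 < δ → δ ≤ 2 →
      volume.real (Metric.thickening δ Ω \ Ω) ≤ C * δ := by
  obtain ⟨x₀, hx₀⟩ := hne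
  obtain ⟨ρ, hρ, hball⟩ := Metric.isOpen_iff.1 hopen x₀ hx₀
  refine ⟨(2 / ρ + 2 / ρ ^ 2) * volume.real Ω, by positivity, fun δ hδ hδ2 => ?_⟩
  have hsub : Ω ⊆ Metric.thickening δ Ω := Metric.self_subset_thickening hδ Ω
  have hfin : volume Ω ≠ ∞ := hbdd.measure_lt_top.ne
  rw [measureReal_sdiff hsub hopen.measurableSet hbdd.thickening.measure_lt_top.ne]
  have h1 : volume.real (Metric.thickening δ Ω) ≤ (1 + δ / ρ) ^ 2 * volume.real Ω := by
    have := measure_mono (μ := volume) (thickening_subset_homothety hconv hρ hδ hball)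
    rw [Measure.addHaar_image_homothety] at this
    have h2 := ENNReal.toReal_mono (by finiteness) this
    rw [ENNReal.toReal_mul, ENNReal.toReal_ofReal (abs_nonneg _), finrank_euclideanSpace_fin,
      abs_of_nonneg (by positivity)] at h2
    exact h2
  have hV : 0 ≤ volume.real Ω := measureReal_nonneg
  have h3 : (1 + δ / ρ) ^ 2 - 1 ≤ (2 / ρ + 2 / ρ ^ 2) * δ := by
    have : δ ^ 2 ≤ 2 * δ := by nlinarith
    have h4 : δ ^ 2 / ρ ^ 2 ≤ 2 * δ / ρ ^ 2 := by gcongr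
    calc (1 + δ / ρ) ^ 2 - 1 = 2 / ρ * δ + δ ^ 2 / ρ ^ 2 := by ring
      _ ≤ 2 / ρ * δ + 2 * δ / ρ ^ 2 := by gcongr
      _ = _ := by ring
  nlinarith [mul_le_mul_of_nonneg_right h3 hV]

/-! ### Orthonormal frames of the plane -/

/-- The orthonormal basis of the plane with members `e'` and `e`. -/
noncomputable def frameBasis {e' e : Plane} (h : Orthonormal ℝ ![e', e]) :
    OrthonormalBasis (Fin 2) ℝ Plane :=
  OrthonormalBasis.mk h (by
    rw [h.linearIndependent.span_eq_top_of_card_eq_finrank' (by simp)])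

theorem frameBasis_zero {e' e : Plane} (h : Orthonormal ℝ ![e', e]) : frameBasis h 0 = e' := by
  simp [frameBasis]

theorem frameBasis_one {e' e : Plane} (h : Orthonormal ℝ ![e', e]) : frameBasis h 1 = e := by
  simp [frameBasis]

theorem inner_eq_of_frame {e' e : Plane} (h : Orthonormal ℝ ![e', e]) (x y : Plane) :
    inner ℝ x y = inner ℝ e' x * inner ℝ e' y + inner ℝ e x * inner ℝ e y := by
  have := (frameBasis h).sum_inner_mul_inner x y
  rw [Fin.sum_univ_two, frameBasis_zero, frameBasis_one] at this
  rw [← this, real_inner_comm e' x, real_inner_comm e x]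

theorem norm_sq_eq_of_frame {e' e : Plane} (h : Orthonormal ℝ ![e', e]) (x : Plane) :
    ‖x‖ ^ 2 = (inner ℝ e' x) ^ 2 + (inner ℝ e x) ^ 2 := by
  rw [← real_inner_self_eq_norm_sq, inner_eq_of_frame h]
  ring

theorem frame_inner_self_left {e' e : Plane} (h : Orthonormal ℝ ![e', e]) :
    inner ℝ e' e' = (1 : ℝ) := by
  have : ‖e'‖ = 1 := h.1 0
  rw [real_inner_self_eq_norm_sq, this, one_pow]

theorem frame_inner_self_right {e' e : Plane} (h : Orthonormal ℝ ![e', e]) :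
    inner ℝ e e = (1 : ℝ) := by
  have : ‖e‖ = 1 := h.1 1
  rw [real_inner_self_eq_norm_sq, this, one_pow]

theorem frame_inner {e' e : Plane} (h : Orthonormal ℝ ![e', e]) : inner ℝ e' e = (0 : ℝ) := by
  simpa using h.2 (show (0 : Fin 2) ≠ 1 by decide)

theorem orthonormal_frame_iff {e' e : Plane} :
    Orthonormal ℝ ![e', e] ↔ ‖e'‖ = 1 ∧ ‖e‖ = 1 ∧ inner ℝ e' e = (0 : ℝ) := by
  constructor
  · intro h
    exact ⟨by simpa using h.1 0, by simpa using h.1 1, frame_inner h⟩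
  · rintro ⟨h0, h1, h2⟩
    refine ⟨fun i => by fin_cases i <;> simpa, fun i j hij => ?_⟩
    fin_cases i <;> fin_cases j <;> simp_all [real_inner_comm]

theorem frame_neg {e' e : Plane} (h : Orthonormal ℝ ![e', e]) : Orthonormal ℝ ![e', -e] := by
  rw [orthonormal_frame_iff] at h ⊢
  simpa using h

theorem frame_swap {e' e : Plane} (h : Orthonormal ℝ ![e', e]) : Orthonormal ℝ ![e, e'] := by
  rw [orthonormal_frame_iff] at h ⊢
  exact ⟨h.2.1, h.1, by rw [real_inner_comm]; exact h.2.2⟩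

/-- Two points of the plane with the same coordinate along `e'` differ by a multiple of `e`. -/
theorem sub_eq_smul_of_inner_eq {e' e : Plane} (h : Orthonormal ℝ ![e', e]) {p q : Plane}
    (hpq : inner ℝ e' p = (inner ℝ e' q : ℝ)) : q - p = (inner ℝ e (q - p) : ℝ) • e := by
  have := (frameBasis h).sum_repr' (q - p)
  rw [Fin.sum_univ_two, frameBasis_zero, frameBasis_one, inner_sub_right e' q p, hpq, sub_self,
    zero_smul, zero_add] at this
  exact this.symm

/-! ### Boundary normals of a convex set -/

theorem IsOuterUnitNormal.inner_nonpos_of_mem_closure {Ω : Set Plane} {p m x : Plane}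
    (h : IsOuterUnitNormal Ω p m) (hx : x ∈ closure Ω) : inner ℝ m (x - p) ≤ (0 : ℝ) := by
  have hc : IsClosed {x : Plane | inner ℝ m (x - p) ≤ (0 : ℝ)} :=
    isClosed_le (by fun_prop) continuous_const
  exact closure_minimal (fun x hx => h.2 x hx) hc hx

theorem IsOuterUnitNormal.inner_neg_of_mem {Ω : Set Plane} (hopen : IsOpen Ω) {p m x : Plane}
    (h : IsOuterUnitNormal Ω p m) (hx : x ∈ Ω) : inner ℝ m (x - p) < (0 : ℝ) := by
  obtain ⟨ε, hε, hb⟩ := Metric.isOpen_iff.1 hopen x hx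
  have hmem : x + (ε / 2) • m ∈ Ω := by
    apply hb
    rw [Metric.mem_ball, dist_eq_norm, add_sub_cancel_left, norm_smul, h.1, mul_one,
      Real.norm_eq_abs, abs_of_pos (by positivity)]
    linarith
  have h1 := h.2 _ hmem
  rw [add_sub_right_comm, inner_add_right, inner_smul_right, real_inner_self_eq_norm_sq, h.1] at h1
  linarith

/-- The part of the boundary that is seen from infinity in direction `e`, above interior points. -/
def topPart (Ω : Set Plane) (e : Plane) : Set Plane :=
  frontier Ω ∩ {p | ∃ t : ℝ, 0 < t ∧ p - t • e ∈ Ω}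

theorem measurableSet_topPart {Ω : Set Plane} (hopen : IsOpen Ω) (e : Plane) :
    MeasurableSet (topPart Ω e) := by
  refine isClosed_frontier.measurableSet.inter (IsOpen.measurableSet ?_)
  have : {p : Plane | ∃ t : ℝ, 0 < t ∧ p - t • e ∈ Ω} =
      ⋃ t ∈ Set.Ioi (0 : ℝ), (fun p => p - t • e) ⁻¹' Ω := by
    ext p; simp
  rw [this]
  exact isOpen_biUnion fun t _ => hopen.preimage (by fun_prop)

section Normal

variable {Ω : Set Plane} {n : Plane → Plane} {e' e : Plane}

theorem inner_normal_pos_of_mem_topPart (hopen : IsOpen Ω)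
    (hn : ∀ p ∈ frontier Ω, IsOuterUnitNormal Ω p (n p)) {p : Plane} (hp : p ∈ topPart Ω e) :
    0 < (inner ℝ e (n p) : ℝ) := by
  obtain ⟨hpf, t, ht, hpt⟩ := hp
  have := (hn p hpf).inner_neg_of_mem hopen hpt
  rw [sub_sub_cancel_left, inner_neg_right, inner_smul_right, real_inner_comm] at this
  by_contra hcon
  nlinarith

/-- Boundary points with a normal pointing towards the side of `e` are determined by their
coordinate along `e'`. -/
theorem eq_of_inner_eq_of_inner_normal_pos (h : Orthonormal ℝ ![e', e])
    (hn : ∀ p ∈ frontier Ω, IsOuterUnitNormal Ω p (n p)) {p q : Plane}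
    (hp : p ∈ frontier Ω) (hq : q ∈ frontier Ω) (hp0 : 0 < (inner ℝ e (n p) : ℝ))
    (hq0 : 0 < (inner ℝ e (n q) : ℝ)) (hpq : inner ℝ e' p = (inner ℝ e' q : ℝ)) : p = q := by
  have hd := sub_eq_smul_of_inner_eq h hpq
  have h1 := (hn p hp).inner_nonpos_of_mem_closure (frontier_subset_closure hq)
  have h2 := (hn q hq).inner_nonpos_of_mem_closure (frontier_subset_closure hp)
  rw [← neg_sub q p, inner_neg_right] at h2
  rw [hd, inner_smul_right] at h1 h2
  rw [real_inner_comm e (n p)] at h1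
  rw [real_inner_comm e (n q)] at h2
  have h3 : (inner ℝ e (q - p) : ℝ) = 0 := by
    apply le_antisymm <;> by_contra hcon <;> nlinarith
  rw [h3, zero_smul, sub_eq_zero] at hd
  exact hd.symm

theorem injOn_inner_topPart (h : Orthonormal ℝ ![e', e]) (hopen : IsOpen Ω)
    (hn : ∀ p ∈ frontier Ω, IsOuterUnitNormal Ω p (n p)) :
    Set.InjOn (fun p : Plane => (inner ℝ e' p : ℝ)) (topPart Ω e) := fun _ hp _ hq hpq =>
  eq_of_inner_eq_of_inner_normal_pos h hn hp.1 hq.1 (inner_normal_pos_of_mem_topPart hopen hn hp)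
    (inner_normal_pos_of_mem_topPart hopen hn hq) hpq

/-- The slope of the boundary, as seen through the normals, is monotone along the top part. -/
theorem slope_le_slope (h : Orthonormal ℝ ![e', e]) (hopen : IsOpen Ω)
    (hn : ∀ p ∈ frontier Ω, IsOuterUnitNormal Ω p (n p)) {p q : Plane}
    (hp : p ∈ topPart Ω e) (hq : q ∈ topPart Ω e) (hpq : inner ℝ e' p ≤ (inner ℝ e' q : ℝ)) :
    (inner ℝ e' (n p) : ℝ) / inner ℝ e (n p) ≤ (inner ℝ e' (n q) : ℝ) / inner ℝ e (n q) := by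
  rcases hpq.eq_or_lt with heq | hlt
  · rw [injOn_inner_topPart h hopen hn hp hq heq]
  have hp0 := inner_normal_pos_of_mem_topPart hopen hn hp
  have hq0 := inner_normal_pos_of_mem_topPart hopen hn hq
  have h1 := (hn p hp.1).inner_nonpos_of_mem_closure (frontier_subset_closure hq.1)
  have h2 := (hn q hq.1).inner_nonpos_of_mem_closure (frontier_subset_closure hp.1)
  rw [← neg_sub q p, inner_neg_right] at h2
  rw [inner_eq_of_frame h] at h1 h2
  have hx : 0 < (inner ℝ e' (q - p) : ℝ) := by rw [inner_sub_right]; linarith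
  rw [div_le_div_iff₀ hp0 hq0]
  set x : ℝ := inner ℝ e' (q - p)
  set y : ℝ := inner ℝ e (q - p)
  set a : ℝ := inner ℝ e' (n p)
  set b : ℝ := inner ℝ e (n p)
  set a' : ℝ := inner ℝ e' (n q)
  set b' : ℝ := inner ℝ e (n q)
  have h3 : (a * b') * x ≤ (a' * b) * x := by nlinarith
  exact le_of_mul_le_mul_right h3 hx

theorem measurable_slope (h : Orthonormal ℝ ![e', e]) (hopen : IsOpen Ω)
    (hn : ∀ p ∈ frontier Ω, IsOuterUnitNormal Ω p (n p)) :
    Measurable fun p : topPart Ω e => (inner ℝ e' (n p) : ℝ) / inner ℝ e (n p) := by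
  refine measurable_of_Iio fun c => ?_
  set S : Set ℝ := {s | ∃ p ∈ topPart Ω e,
    (inner ℝ e' (n p) : ℝ) / inner ℝ e (n p) < c ∧ s ≤ inner ℝ e' p}
  have hS : S.OrdConnected := ⟨fun _ _ y ⟨p, hp, hpc, hyp⟩ z hz => ⟨p, hp, hpc, hz.2.trans hyp⟩⟩
  have heq : (fun p : topPart Ω e => (inner ℝ e' (n p) : ℝ) / inner ℝ e (n p)) ⁻¹' Set.Iio c =
      (fun p : topPart Ω e => (inner ℝ e' (p : Plane) : ℝ)) ⁻¹' S := by
    ext q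
    constructor
    · intro hq
      exact ⟨q, q.2, hq, le_rfl⟩
    · rintro ⟨p, hp, hpc, hqp⟩
      exact (slope_le_slope h hopen hn q.2 hp hqp).trans_lt hpc
  rw [heq]
  exact hS.measurableSet.preimage (by fun_prop)

theorem inner_normal_eq_of_slope (h : Orthonormal ℝ ![e', e]) {m : Plane} (hm : ‖m‖ = 1)
    (hpos : 0 < (inner ℝ e m : ℝ)) :
    (inner ℝ e m : ℝ) = (√(1 + ((inner ℝ e' m : ℝ) / inner ℝ e m) ^ 2))⁻¹ := by
  have h1 := norm_sq_eq_of_frame h m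
  rw [hm] at h1
  have : 1 + ((inner ℝ e' m : ℝ) / inner ℝ e m) ^ 2 = ((inner ℝ e m : ℝ)⁻¹) ^ 2 := by
    field_simp; linarith
  rw [this, Real.sqrt_sq (by positivity), inv_inv]

theorem measurable_inner_normal_right (h : Orthonormal ℝ ![e', e]) (hopen : IsOpen Ω)
    (hn : ∀ p ∈ frontier Ω, IsOuterUnitNormal Ω p (n p)) :
    Measurable fun p : topPart Ω e => (inner ℝ e (n p) : ℝ) := by
  have := measurable_slope h hopen hn
  have h2 : Measurable fun p : topPart Ω e =>
      (√(1 + ((inner ℝ e' (n p) : ℝ) / inner ℝ e (n p)) ^ 2))⁻¹ := by fun_prop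
  convert h2 using 2 with p
  exact inner_normal_eq_of_slope h (hn p p.2.1).1 (inner_normal_pos_of_mem_topPart hopen hn p.2)

theorem measurable_inner_normal_left (h : Orthonormal ℝ ![e', e]) (hopen : IsOpen Ω)
    (hn : ∀ p ∈ frontier Ω, IsOuterUnitNormal Ω p (n p)) :
    Measurable fun p : topPart Ω e => (inner ℝ e' (n p) : ℝ) := by
  have := (measurable_slope h hopen hn).mul (measurable_inner_normal_right h hopen hn)
  convert this using 2 with p
  exact (div_mul_cancel₀ _ (inner_normal_pos_of_mem_topPart hopen hn p.2).ne').symm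

end Normal

/-! ### Boundary length -/

theorem eq_Ioo_of_isOpen_of_ordConnected {S : Set ℝ} (hopen : IsOpen S) (hne : S.Nonempty)
    (hbdd : Bornology.IsBounded S) (hconv : S.OrdConnected) : S = Set.Ioo (sInf S) (sSup S) := by
  have hb := isBounded_iff_bddBelow_bddAbove.1 hbdd
  apply Set.Subset.antisymm
  · intro x hx
    obtain ⟨ε, hε, hball⟩ := Metric.isOpen_iff.1 hopen x hx
    rw [Real.ball_eq_Ioo] at hball
    have h1 := csInf_le hb.1 (hball ⟨by linarith, by linarith⟩ : x - ε / 2 ∈ S)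
    have h2 := le_csSup hb.2 (hball ⟨by linarith, by linarith⟩ : x + ε / 2 ∈ S)
    exact ⟨by linarith, by linarith⟩
  · intro x hx
    obtain ⟨y, hy, hyx⟩ := exists_lt_of_csInf_lt hne hx.1
    obtain ⟨z, hz, hxz⟩ := exists_lt_of_lt_csSup hne hx.2
    exact hconv.out hy hz ⟨hyx.le, hxz.le⟩

section Length

variable {Ω : Set Plane} {n : Plane → Plane} {e' e : Plane}

theorem image_inner_eq_Ioo (hopen : IsOpen Ω) (hne : Ω.Nonempty)
    (hbdd : Bornology.IsBounded Ω) (hconv : Convex ℝ Ω) (he' : e' ≠ 0) :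
    ∃ a b : ℝ, (fun p : Plane => (inner ℝ e' p : ℝ)) '' Ω = Set.Ioo a b := by
  refine ⟨_, _, eq_Ioo_of_isOpen_of_ordConnected ?_ (hne.image _) ?_ ?_⟩
  · refine (innerSL ℝ e').isOpenMap_of_ne_zero ?_ Ω hopen
    intro h0
    apply he'
    have := congrArg (fun f => f e') h0
    simpa using this
  · exact (innerSL ℝ e').lipschitz.isBounded_image hbdd
  · exact (hconv.linear_image (innerSL ℝ e').toLinearMap).ordConnected

theorem frame_ne_zero_left (h : Orthonormal ℝ ![e', e]) : e' ≠ 0 := h.ne_zero 0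

/-- Only the (at most two) corners over the end points of the shadow have a normal pointing to the
side of `e` without lying above an interior point. -/
theorem finite_normal_pos_diff_topPart (h : Orthonormal ℝ ![e', e]) (hopen : IsOpen Ω)
    (hne : Ω.Nonempty) (hbdd : Bornology.IsBounded Ω) (hconv : Convex ℝ Ω)
    (hn : ∀ p ∈ frontier Ω, IsOuterUnitNormal Ω p (n p)) :
    ({p ∈ frontier Ω | 0 < (inner ℝ e (n p) : ℝ)} \ topPart Ω e).Finite := by
  obtain ⟨a, b, hab⟩ := image_inner_eq_Ioo (e' := e') hopen hne hbdd hconv (frame_ne_zero_left h)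
  have hlt : a < b := by
    have := hne.image (fun p : Plane => (inner ℝ e' p : ℝ))
    rw [hab] at this
    exact Set.nonempty_Ioo.1 this
  refine Set.Finite.of_finite_image (f := fun p : Plane => (inner ℝ e' p : ℝ))
    (Set.Finite.subset (Set.toFinite {a, b}) ?_) ?_
  · rintro _ ⟨p, ⟨⟨hp, hp0⟩, hpT⟩, rfl⟩
    have hmem : (inner ℝ e' p : ℝ) ∈ closure ((fun p : Plane => (inner ℝ e' p : ℝ)) '' Ω) :=
      image_closure_subset_closure_image (by fun_prop) ⟨p, frontier_subset_closure hp, rfl⟩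
    have hnot : (inner ℝ e' p : ℝ) ∉ (fun p : Plane => (inner ℝ e' p : ℝ)) '' Ω := by
      rintro ⟨x, hx, hxp⟩
      apply hpT
      refine ⟨hp, -inner ℝ e (x - p), ?_, ?_⟩
      · have h1 := (hn p hp).inner_neg_of_mem hopen hx
        rw [sub_eq_smul_of_inner_eq h hxp.symm, inner_smul_right, real_inner_comm e (n p)] at h1
        by_contra hcon
        nlinarith
      · rw [neg_smul, sub_neg_eq_add, ← sub_eq_smul_of_inner_eq h hxp.symm, add_sub_cancel]
        exact hx
    rw [hab, closure_Ioo hlt.ne] at hmem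
    rw [hab] at hnot
    simp only [Set.mem_insert_iff, Set.mem_singleton_iff]
    by_contra! hcon
    exact hnot ⟨lt_of_le_of_ne hmem.1 hcon.1.symm, lt_of_le_of_ne hmem.2 hcon.2⟩
  · intro p hp q hq hpq
    exact eq_of_inner_eq_of_inner_normal_pos h hn hp.1.1 hq.1.1 hp.1.2 hq.1.2 hpq

/-- Where a coordinate is expanding up to the factor `K`, it controls length from above. -/
theorem hausdorffMeasure_le_of_norm_sub_le {E : Set Plane} {K : NNReal}
    (hE : ∀ p ∈ E, ∀ q ∈ E, ‖p - q‖ ≤ K * |(inner ℝ e' (p - q) : ℝ)|) :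
    (Measure.hausdorffMeasure 1 : Measure Plane) E ≤
      K * volume ((fun p : Plane => (inner ℝ e' p : ℝ)) '' E) := by
  have hanti : AntilipschitzWith K (fun p : E => (inner ℝ e' (p : Plane) : ℝ)) := by
    refine AntilipschitzWith.of_le_mul_dist fun p q => ?_
    rw [Real.dist_eq, ← inner_sub_right, Subtype.dist_eq, dist_eq_norm]
    exact hE p p.2 q q.2
  have h1 := hanti.le_hausdorffMeasure_image zero_le_one Set.univ
  rw [hausdorffMeasure_real, ENNReal.rpow_one, Set.image_univ] at h1
  have h2 := (isometry_subtype_coe (s := E)).hausdorffMeasure_image (d := 1)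
    (Or.inl zero_le_one) Set.univ
  rw [Set.image_univ, Subtype.range_coe] at h2
  rw [h2]
  convert h1 using 3
  ext x; simp

/-- Where a coordinate contracts up to the factor `K`, it controls length from below. -/
theorem volume_image_inner_le {E : Set Plane} {K : NNReal}
    (hE : ∀ p ∈ E, ∀ q ∈ E, |(inner ℝ e' (p - q) : ℝ)| ≤ K * ‖p - q‖) :
    volume ((fun p : Plane => (inner ℝ e' p : ℝ)) '' E) ≤
      K * (Measure.hausdorffMeasure 1 : Measure Plane) E := by
  have hlip : LipschitzOnWith K (fun p : Plane => (inner ℝ e' p : ℝ)) E := by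
    refine LipschitzOnWith.of_dist_le_mul fun p hp q hq => ?_
    rw [Real.dist_eq, ← inner_sub_right, dist_eq_norm]
    exact hE p hp q hq
  have h1 := hlip.hausdorffMeasure_image_le zero_le_one
  rwa [hausdorffMeasure_real, ENNReal.rpow_one] at h1

theorem hausdorffMeasure_normal_ge_half_lt_top (h : Orthonormal ℝ ![e', e])
    (hbdd : Bornology.IsBounded Ω) (hn : ∀ p ∈ frontier Ω, IsOuterUnitNormal Ω p (n p)) :
    (Measure.hausdorffMeasure 1 : Measure Plane)
      {p ∈ frontier Ω | 1 / 2 ≤ (inner ℝ e (n p) : ℝ)} < ∞ := by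
  have key : ∀ p ∈ {p ∈ frontier Ω | 1 / 2 ≤ (inner ℝ e (n p) : ℝ)},
      ∀ q ∈ {p ∈ frontier Ω | 1 / 2 ≤ (inner ℝ e (n p) : ℝ)},
      (inner ℝ e (q - p) : ℝ) ≤ 2 * |(inner ℝ e' (q - p) : ℝ)| := by
    rintro p ⟨hp, hp2⟩ q ⟨hq, -⟩
    have h1 := (hn p hp).inner_nonpos_of_mem_closure (frontier_subset_closure hq)
    rw [inner_eq_of_frame h] at h1
    have h3 := norm_sq_eq_of_frame h (n p)
    rw [(hn p hp).1] at h3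
    have h4 : |(inner ℝ e' (n p) : ℝ)| ≤ 1 := by
      rw [← sq_le_one_iff_abs_le_one]; nlinarith [sq_nonneg (inner ℝ e (n p) : ℝ)]
    have h5 : -(inner ℝ e' (n p) * inner ℝ e' (q - p) : ℝ) ≤ |(inner ℝ e' (q - p) : ℝ)| := by
      refine (neg_le_abs _).trans ?_
      rw [abs_mul]
      exact mul_le_of_le_one_left (abs_nonneg _) h4
    rcases le_or_gt (inner ℝ e (q - p) : ℝ) 0 with hneg | hpos
    · exact hneg.trans (by positivity)
    · nlinarith
  refine (hausdorffMeasure_le_of_norm_sub_le (K := 3) (e' := e') ?_).trans_lt ?_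
  · intro p hp q hq
    have h1 := key p hp q hq
    have h2 := key q hq p hp
    rw [← neg_sub q p, inner_neg_right, inner_neg_right, abs_neg] at *
    have h3 : |(inner ℝ e (q - p) : ℝ)| ≤ 2 * |(inner ℝ e' (q - p) : ℝ)| := abs_le'.2 ⟨h1, h2⟩
    rw [norm_neg]
    refine abs_le_of_sq_le_sq' ?_ (by positivity) |>.2
    rw [norm_sq_eq_of_frame h, ← sq_abs (inner ℝ e (q - p) : ℝ), ← sq_abs (inner ℝ e' (q - p) : ℝ)]
    push_cast
    nlinarith [abs_nonneg (inner ℝ e (q - p) : ℝ), abs_nonneg (inner ℝ e' (q - p) : ℝ)]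
  · refine ENNReal.mul_lt_top (by simp) (Bornology.IsBounded.measure_lt_top ?_)
    exact (innerSL ℝ e').lipschitz.isBounded_image
      (hbdd.closure.subset (fun p hp => frontier_subset_closure hp.1))

/-- The boundary of a bounded convex set of the plane has finite length. -/
theorem hausdorffMeasure_frontier_lt_top (hbdd : Bornology.IsBounded Ω)
    (hn : ∀ p ∈ frontier Ω, IsOuterUnitNormal Ω p (n p)) :
    (Measure.hausdorffMeasure 1 : Measure Plane) (frontier Ω) < ∞ := by
  set b := EuclideanSpace.basisFun (Fin 2) ℝ
  have h : Orthonormal ℝ ![b 0, b 1] := by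
    rw [orthonormal_frame_iff]
    exact ⟨b.orthonormal.1 0, b.orthonormal.1 1, b.orthonormal.2 (by decide)⟩
  set Q : Plane → Set Plane := fun e => {p ∈ frontier Ω | 1 / 2 ≤ (inner ℝ e (n p) : ℝ)}
  have hcover : frontier Ω ⊆ (Q (b 1) ∪ Q (-b 1)) ∪ (Q (b 0) ∪ Q (-b 0)) := by
    intro p hp
    by_contra hcon
    simp only [Q, Set.mem_union, Set.mem_ofPred_eq, hp, true_and, inner_neg_left, not_or,
      not_le] at hcon
    obtain ⟨⟨h1, h2⟩, h3, h4⟩ := hcon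
    have h5 := norm_sq_eq_of_frame h (n p)
    rw [(hn p hp).1] at h5
    nlinarith
  refine (measure_mono hcover).trans_lt (measure_union_lt_top (measure_union_lt_top ?_ ?_)
    (measure_union_lt_top ?_ ?_))
  · exact hausdorffMeasure_normal_ge_half_lt_top h hbdd hn
  · exact hausdorffMeasure_normal_ge_half_lt_top (frame_neg h) hbdd hn
  · exact hausdorffMeasure_normal_ge_half_lt_top (frame_swap h) hbdd hn
  · exact hausdorffMeasure_normal_ge_half_lt_top (frame_neg (frame_swap h)) hbdd hn

end Length

/-! ### The projection of boundary length onto a line -/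

section Area

variable {Ω : Set Plane} {n : Plane → Plane} {e' e : Plane}

/-- A vector nearly orthogonal to the unit vector `m` has `e'`-coordinate nearly `⟪e, m⟫` times its
length, up to sign. -/
theorem abs_inner_bounds_of_nearly_orthogonal (h : Orthonormal ℝ ![e', e]) {m d : Plane} {ε : ℝ}
    (hm : ‖m‖ = 1) (hpos : 0 ≤ (inner ℝ e m : ℝ)) (hε : 0 ≤ ε)
    (hmd : |(inner ℝ m d : ℝ)| ≤ ε * ‖d‖) :
    |(inner ℝ e' d : ℝ)| ≤ (inner ℝ e m + ε) * ‖d‖ ∧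
      (inner ℝ e m - 2 * ε) * ‖d‖ ≤ |(inner ℝ e' d : ℝ)| := by
  have hm2 := norm_sq_eq_of_frame h m
  have hd2 := norm_sq_eq_of_frame h d
  rw [inner_eq_of_frame h] at hmd
  rw [hm] at hm2
  set a : ℝ := inner ℝ e' m
  set b : ℝ := inner ℝ e m
  set x : ℝ := inner ℝ e' d
  set y : ℝ := inner ℝ e d
  set D : ℝ := ‖d‖
  have hD : 0 ≤ D := norm_nonneg d
  -- `w` and `r` are the components of `d` along `m` and along its orthogonal.
  set w : ℝ := a * x + b * y with hw
  set r : ℝ := b * x - a * y with hr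
  have hx : x = a * w + b * r := by
    have : x = (a ^ 2 + b ^ 2) * x := by rw [← hm2]; ring
    rw [hw, hr]; linarith
  have hwr : w ^ 2 + r ^ 2 = D ^ 2 := by
    rw [hd2, hw, hr]; linear_combination (-(x ^ 2 + y ^ 2)) * hm2
  have ha1 : |a| ≤ 1 := by rw [← sq_le_one_iff_abs_le_one]; nlinarith [sq_nonneg b]
  have hb1 : b ≤ 1 := by nlinarith [sq_nonneg a]
  have hrD : |r| ≤ D := abs_le_of_sq_le_sq (by nlinarith [sq_nonneg w]) hD
  have hDr : D ≤ |w| + |r| := by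
    refine abs_le_of_sq_le_sq' ?_ (by positivity) |>.2
    rw [← hwr, ← sq_abs w, ← sq_abs r]
    nlinarith [abs_nonneg w, abs_nonneg r]
  have haw : |a * w| ≤ ε * D := by
    rw [abs_mul]
    exact (mul_le_of_le_one_left (abs_nonneg _) ha1).trans hmd
  have hbr : |b * r| = b * |r| := by rw [abs_mul, abs_of_nonneg hpos]
  constructor
  · calc |x| = |a * w + b * r| := by rw [← hx]
      _ ≤ |a * w| + |b * r| := abs_add_le _ _
      _ ≤ ε * D + b * D := by rw [hbr]; gcongr
      _ = _ := by ring
  · have h1 : |b * r| ≤ |x| + |a * w| := by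
      have : b * r = x - a * w := by rw [hx]; ring
      rw [this]; exact abs_sub _ _
    have h2 : D - ε * D ≤ |r| := by linarith
    have h3 : b * (D - ε * D) ≤ |b * r| := by rw [hbr]; gcongr
    have h4 : b * (ε * D) ≤ 1 * (ε * D) := by gcongr
    nlinarith

/-- On a piece of the boundary on which the normal oscillates by at most `η`, the projection along
`e` scales length by the factor `⟪e, n⟫`, with an error of order `η`. -/
theorem volume_image_inner_near_lintegral (h : Orthonormal ℝ ![e', e]) (hopen : IsOpen Ω)
    (hn : ∀ p ∈ frontier Ω, IsOuterUnitNormal Ω p (n p)) {E : Set Plane} (hE : E ⊆ topPart Ω e)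
    (hEm : MeasurableSet E) {η : ℝ} (hη : 0 ≤ η)
    (hosc' : ∀ p ∈ E, ∀ q ∈ E, |(inner ℝ e' (n p) : ℝ) - inner ℝ e' (n q)| ≤ η)
    (hosc : ∀ p ∈ E, ∀ q ∈ E, |(inner ℝ e (n p) : ℝ) - inner ℝ e (n q)| ≤ η) :
    volume ((fun p : Plane => (inner ℝ e' p : ℝ)) '' E) ≤
        ∫⁻ p in E, ENNReal.ofReal (inner ℝ e (n p)) ∂(Measure.hausdorffMeasure 1)
          + ENNReal.ofReal (5 * η) * (Measure.hausdorffMeasure 1 : Measure Plane) E ∧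
      ∫⁻ p in E, ENNReal.ofReal (inner ℝ e (n p)) ∂(Measure.hausdorffMeasure 1) ≤
        volume ((fun p : Plane => (inner ℝ e' p : ℝ)) '' E)
          + ENNReal.ofReal (5 * η) * (Measure.hausdorffMeasure 1 : Measure Plane) E := by
  set μ : Measure Plane := Measure.hausdorffMeasure 1
  rcases E.eq_empty_or_nonempty with rfl | ⟨p₀, hp₀⟩
  · simp
  set b : ℝ := inner ℝ e (n p₀) with hb
  have hb0 : 0 < b := inner_normal_pos_of_mem_topPart hopen hn (hE hp₀)
  have hclose : ∀ p ∈ E, ‖n p₀ - n p‖ ≤ 2 * η := by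
    intro p hp
    refine abs_le_of_sq_le_sq' ?_ (by positivity) |>.2
    have h1 := hosc' p₀ hp₀ p hp
    have h2 := hosc p₀ hp₀ p hp
    rw [norm_sq_eq_of_frame h, inner_sub_right, inner_sub_right]
    have h3 := sq_le_sq' (abs_le.1 h1).1 (abs_le.1 h1).2
    have h4 := sq_le_sq' (abs_le.1 h2).1 (abs_le.1 h2).2
    nlinarith
  have hle : ∀ p ∈ E, ∀ q ∈ E, (inner ℝ (n p₀) (q - p) : ℝ) ≤ 2 * η * ‖q - p‖ := by
    intro p hp q hq
    have h1 := (hn p (hE hp).1).inner_nonpos_of_mem_closure (frontier_subset_closure (hE hq).1)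
    have h2 : (inner ℝ (n p₀) (q - p) : ℝ) = inner ℝ (n p) (q - p)
        + inner ℝ (n p₀ - n p) (q - p) := by rw [← inner_add_left, add_sub_cancel]
    have h3 := (real_inner_le_norm (n p₀ - n p) (q - p)).trans
      (mul_le_mul_of_nonneg_right (hclose p hp) (norm_nonneg _))
    linarith
  have hbd : ∀ p ∈ E, ∀ q ∈ E, |(inner ℝ e' (p - q) : ℝ)| ≤ (b + 2 * η) * ‖p - q‖ ∧
      (b - 2 * (2 * η)) * ‖p - q‖ ≤ |(inner ℝ e' (p - q) : ℝ)| := by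
    intro p hp q hq
    refine abs_inner_bounds_of_nearly_orthogonal h (hn p₀ (hE hp₀).1).1 hb0.le (by positivity) ?_
    refine abs_le'.2 ⟨hle q hq p hp, ?_⟩
    rw [← inner_neg_right, neg_sub, norm_sub_rev]
    exact hle p hp q hq
  have hupper : volume ((fun p : Plane => (inner ℝ e' p : ℝ)) '' E) ≤
      ENNReal.ofReal (b + 2 * η) * μ E :=
    volume_image_inner_le (K := (b + 2 * η).toNNReal) fun p hp q hq => by
      rw [Real.coe_toNNReal _ (by positivity)]
      exact (hbd p hp q hq).1
  have hlower : ENNReal.ofReal (b - 4 * η) * μ E ≤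
      volume ((fun p : Plane => (inner ℝ e' p : ℝ)) '' E) := by
    rcases le_or_gt (b - 4 * η) 0 with hneg | hpos
    · simp [ENNReal.ofReal_of_nonpos hneg]
    have h1 : μ E ≤ ENNReal.ofReal (b - 4 * η)⁻¹ *
        volume ((fun p : Plane => (inner ℝ e' p : ℝ)) '' E) :=
      hausdorffMeasure_le_of_norm_sub_le (K := ((b - 4 * η)⁻¹).toNNReal) fun p hp q hq => by
        rw [Real.coe_toNNReal _ (by positivity), inv_mul_eq_div, le_div_iff₀ hpos]
        have := (hbd p hp q hq).2
        linarith
    calc ENNReal.ofReal (b - 4 * η) * μ E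
        ≤ ENNReal.ofReal (b - 4 * η) * (ENNReal.ofReal (b - 4 * η)⁻¹ *
          volume ((fun p : Plane => (inner ℝ e' p : ℝ)) '' E)) := by gcongr
      _ = _ := by
        rw [← mul_assoc, ← ENNReal.ofReal_mul hpos.le, mul_inv_cancel₀ hpos.ne',
          ENNReal.ofReal_one, one_mul]
  have hint_le : ∫⁻ p in E, ENNReal.ofReal (inner ℝ e (n p)) ∂μ ≤ ENNReal.ofReal (b + η) * μ E := by
    rw [← setLIntegral_const]
    refine setLIntegral_mono' hEm fun p hp => ENNReal.ofReal_le_ofReal ?_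
    have := (abs_le.1 (hosc p hp p₀ hp₀)).2
    linarith
  have hle_int : ENNReal.ofReal (b - η) * μ E ≤ ∫⁻ p in E, ENNReal.ofReal (inner ℝ e (n p)) ∂μ := by
    rw [← setLIntegral_const]
    refine setLIntegral_mono' hEm fun p hp => ENNReal.ofReal_le_ofReal ?_
    have := (abs_le.1 (hosc p hp p₀ hp₀)).1
    linarith
  -- The constant `5` serves both directions: the gaps are `3 * η` and `5 * η`.
  constructor
  · calc _ ≤ ENNReal.ofReal (b + 2 * η) * μ E := hupper
      _ ≤ (ENNReal.ofReal (b - η) + ENNReal.ofReal (5 * η)) * μ E := by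
        gcongr
        refine le_trans (ENNReal.ofReal_le_ofReal ?_) ENNReal.ofReal_add_le
        linarith
      _ ≤ _ := by rw [add_mul]; gcongr
  · calc _ ≤ ENNReal.ofReal (b + η) * μ E := hint_le
      _ ≤ (ENNReal.ofReal (b - 4 * η) + ENNReal.ofReal (5 * η)) * μ E := by
        gcongr
        refine le_trans (ENNReal.ofReal_le_ofReal ?_) ENNReal.ofReal_add_le
        linarith
      _ ≤ _ := by rw [add_mul]; gcongr

/-- Area formula for the projection of the top part of the boundary along `e`. -/
theorem volume_image_inner_eq_lintegral (h : Orthonormal ℝ ![e', e]) (hopen : IsOpen Ω)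
    (hbdd : Bornology.IsBounded Ω)
    (hn : ∀ p ∈ frontier Ω, IsOuterUnitNormal Ω p (n p)) {E : Set Plane} (hE : E ⊆ topPart Ω e)
    (hEm : MeasurableSet E) :
    volume ((fun p : Plane => (inner ℝ e' p : ℝ)) '' E) =
      ∫⁻ p in E, ENNReal.ofReal (inner ℝ e (n p)) ∂(Measure.hausdorffMeasure 1) := by
  set μ : Measure Plane := Measure.hausdorffMeasure 1 with hμ
  set f : Plane → ℝ := fun p => (inner ℝ e' p : ℝ) with hf
  have hinj : Set.InjOn f E := (injOn_inner_topPart h hopen hn).mono hE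
  have hμE : μ E ≠ ∞ := ((measure_mono (hE.trans Set.inter_subset_left)).trans_lt
    (hausdorffMeasure_frontier_lt_top hbdd hn)).ne
  have happrox : ∀ N : ℕ, volume (f '' E) ≤
        ∫⁻ p in E, ENNReal.ofReal (inner ℝ e (n p)) ∂μ + ENNReal.ofReal (5 * (1 / (N + 1))) * μ E ∧
      ∫⁻ p in E, ENNReal.ofReal (inner ℝ e (n p)) ∂μ ≤
        volume (f '' E) + ENNReal.ofReal (5 * (1 / (N + 1))) * μ E := by
    intro N
    -- Split `E` by the position of the normal in a grid of mesh `1 / (N + 1)`.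
    set P : ℤ × ℤ → Set Plane := fun k => E ∩ {p | (⌊((N : ℝ) + 1) * inner ℝ e' (n p)⌋,
      ⌊((N : ℝ) + 1) * inner ℝ e (n p)⌋) = k} with hP
    have hPE : ∀ k, P k ⊆ E := fun k => Set.inter_subset_left
    have hPm : ∀ k, MeasurableSet (P k) := by
      intro k
      have hmeas : Measurable fun p : topPart Ω e =>
          (⌊((N : ℝ) + 1) * inner ℝ e' (n p)⌋, ⌊((N : ℝ) + 1) * inner ℝ e (n p)⌋) :=
        (((measurable_inner_normal_left h hopen hn).const_mul _).floor).prodMk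
          (((measurable_inner_normal_right h hopen hn).const_mul _).floor)
      have h1 := (measurableSet_topPart hopen e).subtype_image (hmeas (measurableSet_singleton k))
      convert hEm.inter h1 using 1
      ext p
      simp only [hP, Set.mem_inter_iff, Set.mem_ofPred_eq, Set.mem_image, Set.mem_preimage,
        Set.mem_singleton_iff, Subtype.exists, exists_and_left, exists_prop, exists_eq_right_right]
      constructor
      · rintro ⟨hp, hpk⟩
        exact ⟨hp, hpk, hE hp⟩
      · rintro ⟨hp, hpk, -⟩
        exact ⟨hp, hpk⟩
    have hPd : Pairwise (Function.onFun Disjoint P) := by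
      intro i j hij
      refine Set.disjoint_left.2 fun p hp hp' => hij ?_
      exact hp.2.symm.trans hp'.2
    have hPU : ⋃ k, P k = E := by
      ext p
      simp [hP]
    have hfP : ∀ k, MeasurableSet (f '' P k) := fun k =>
      (hPm k).image_of_continuousOn_injOn (by fun_prop) (hinj.mono (hPE k))
    have hfd : Pairwise (Function.onFun Disjoint fun k => f '' P k) := by
      intro i j hij
      refine Set.disjoint_left.2 ?_
      rintro _ ⟨p, hp, rfl⟩ ⟨q, hq, hqp⟩
      have := hinj hq.1 hp.1 hqp
      subst this
      exact Set.disjoint_left.1 (hPd hij) hp hq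
    have hv : volume (f '' E) = ∑' k, volume (f '' P k) := by
      rw [← measure_iUnion hfd hfP, ← Set.image_iUnion, hPU]
    have hm : μ E = ∑' k, μ (P k) := by rw [← measure_iUnion hPd hPm, hPU]
    have hi : ∫⁻ p in E, ENNReal.ofReal (inner ℝ e (n p)) ∂μ =
        ∑' k, ∫⁻ p in P k, ENNReal.ofReal (inner ℝ e (n p)) ∂μ := by
      rw [← lintegral_iUnion hPm hPd, hPU]
    have hfloor : ∀ x y : ℝ, ⌊((N : ℝ) + 1) * x⌋ = ⌊((N : ℝ) + 1) * y⌋ →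
        |x - y| ≤ 1 / ((N : ℝ) + 1) := by
      intro x y hxy
      have h1 := Int.abs_sub_lt_one_of_floor_eq_floor hxy
      have hN : (0 : ℝ) < (N : ℝ) + 1 := by positivity
      rw [← mul_sub, abs_mul, abs_of_pos hN] at h1
      rw [le_div_iff₀ hN]
      linarith
    have hk := fun k => volume_image_inner_near_lintegral h hopen hn ((hPE k).trans hE) (hPm k)
      (η := 1 / ((N : ℝ) + 1)) (by positivity)
      (fun p hp q hq => hfloor _ _ (congrArg Prod.fst (hp.2.trans hq.2.symm)))
      (fun p hp q hq => hfloor _ _ (congrArg Prod.snd (hp.2.trans hq.2.symm)))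
    rw [hv, hi, hm, ← ENNReal.tsum_mul_left, ← ENNReal.tsum_add, ← ENNReal.tsum_add]
    exact ⟨ENNReal.tsum_le_tsum fun k => (hk k).1, ENNReal.tsum_le_tsum fun k => (hk k).2⟩
  have hlim : ∀ Y : ℝ≥0∞, Filter.Tendsto
      (fun N : ℕ => Y + ENNReal.ofReal (5 * (1 / ((N : ℝ) + 1))) * μ E) Filter.atTop (𝓝 Y) := by
    intro Y
    have h1 : Filter.Tendsto (fun N : ℕ => ENNReal.ofReal (5 * (1 / ((N : ℝ) + 1)))) Filter.atTop
        (𝓝 0) := by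
      have := (tendsto_one_div_add_atTop_nhds_zero_nat (𝕜 := ℝ)).const_mul 5
      rw [mul_zero] at this
      rw [← ENNReal.ofReal_zero]
      exact (ENNReal.continuous_ofReal.tendsto 0).comp this
    have h2 := (ENNReal.Tendsto.mul_const h1 (Or.inr hμE)).const_add Y
    simpa using h2
  exact le_antisymm (ge_of_tendsto' (hlim _) fun N => (happrox N).1)
    (ge_of_tendsto' (hlim _) fun N => (happrox N).2)

/-! ### Sections of a convex set -/

/-- The height, along `e`, of the upper end of the section of `Ω` over the coordinate `s`. -/
noncomputable def topHeight (Ω : Set Plane) (e' e : Plane) (s : ℝ) : ℝ :=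
  sSup {t : ℝ | s • e' + t • e ∈ Ω}

theorem section_eq_Ioo (h : Orthonormal ℝ ![e', e]) (hopen : IsOpen Ω)
    (hbdd : Bornology.IsBounded Ω) (hconv : Convex ℝ Ω) {s : ℝ}
    (hs : s ∈ (fun p : Plane => (inner ℝ e' p : ℝ)) '' Ω) :
    {t : ℝ | s • e' + t • e ∈ Ω}.Nonempty ∧
    {t : ℝ | s • e' + t • e ∈ Ω} =
      Set.Ioo (sInf {t : ℝ | s • e' + t • e ∈ Ω}) (topHeight Ω e' e s) := by
  have hne : {t : ℝ | s • e' + t • e ∈ Ω}.Nonempty := by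
    obtain ⟨p, hp, rfl⟩ := hs
    refine ⟨inner ℝ e p, ?_⟩
    have := (frameBasis h).sum_repr' p
    rw [Fin.sum_univ_two, frameBasis_zero, frameBasis_one] at this
    simpa only [Set.mem_ofPred_eq, this] using hp
  refine ⟨hne, eq_Ioo_of_isOpen_of_ordConnected (hopen.preimage (by fun_prop)) hne ?_ ?_⟩
  · have hl := (innerSL ℝ e).lipschitz.isBounded_image hbdd
    refine hl.subset fun t ht => ⟨_, ht, ?_⟩
    simp only [innerSL_apply_apply, inner_add_right, inner_smul_right,
      frame_inner (frame_swap h), frame_inner_self_right h]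
    ring
  · refine Convex.ordConnected ?_
    have : {t : ℝ | s • e' + t • e ∈ Ω} = AffineMap.lineMap (s • e') (s • e' + e) ⁻¹' Ω := by
      ext t
      simp [AffineMap.lineMap_apply, add_comm]
    rw [this]
    exact hconv.affine_preimage _

theorem top_mem_topPart (h : Orthonormal ℝ ![e', e]) (hopen : IsOpen Ω)
    (hbdd : Bornology.IsBounded Ω) (hconv : Convex ℝ Ω) {s : ℝ}
    (hs : s ∈ (fun p : Plane => (inner ℝ e' p : ℝ)) '' Ω) :
    s • e' + topHeight Ω e' e s • e ∈ topPart Ω e := by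
  obtain ⟨hne, heq⟩ := section_eq_Ioo h hopen hbdd hconv hs
  set a := sInf {t : ℝ | s • e' + t • e ∈ Ω}
  set b := topHeight Ω e' e s
  have hab : a < b := by rw [heq] at hne; exact Set.nonempty_Ioo.1 hne
  have hmem : ∀ t, s • e' + t • e ∈ Ω ↔ t ∈ Set.Ioo a b := fun t => by
    rw [← heq]; rfl
  refine ⟨?_, (b - a) / 2, by linarith, ?_⟩
  · rw [hopen.frontier_eq]
    refine ⟨?_, fun hb => absurd ((hmem b).1 hb).2 (lt_irrefl _)⟩
    have hb : b ∈ closure (Set.Ioo a b) := by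
      rw [closure_Ioo hab.ne]; exact ⟨hab.le, le_rfl⟩
    have := image_closure_subset_closure_image (f := fun t : ℝ => s • e' + t • e) (by fun_prop)
      ⟨b, hb, rfl⟩
    refine closure_mono ?_ this
    rintro _ ⟨t, ht, rfl⟩
    exact (hmem t).2 ht
  · rw [add_sub_assoc, ← sub_smul]
    exact (hmem _).2 ⟨by linarith, by linarith⟩

theorem image_inner_topPart (h : Orthonormal ℝ ![e', e]) (hopen : IsOpen Ω)
    (hbdd : Bornology.IsBounded Ω) (hconv : Convex ℝ Ω) :
    (fun p : Plane => (inner ℝ e' p : ℝ)) '' topPart Ω e =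
      (fun p : Plane => (inner ℝ e' p : ℝ)) '' Ω := by
  apply Set.Subset.antisymm
  · rintro _ ⟨p, ⟨-, t, -, hpt⟩, rfl⟩
    exact ⟨_, hpt, by simp [inner_sub_right, inner_smul_right, frame_inner h]⟩
  · intro s hs
    refine ⟨_, top_mem_topPart h hopen hbdd hconv hs, ?_⟩
    simp only [inner_add_right, inner_smul_right, frame_inner h, frame_inner_self_left h, mul_one,
      mul_zero, add_zero]

/-- The measure `⟪e, n⟫ ds` on the top part of the boundary projects onto Lebesgue measure on the
shadow of `Ω`. -/
theorem map_inner_withDensity_eq_restrict (h : Orthonormal ℝ ![e', e]) (hopen : IsOpen Ω)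
    (hbdd : Bornology.IsBounded Ω) (hconv : Convex ℝ Ω)
    (hn : ∀ p ∈ frontier Ω, IsOuterUnitNormal Ω p (n p)) :
    (((Measure.hausdorffMeasure 1 : Measure Plane).comap
        (Subtype.val : topPart Ω e → Plane)).withDensity
          fun p => ENNReal.ofReal (inner ℝ e (n p))).map
        ((topPart Ω e).domRestrict fun p : Plane => (inner ℝ e' p : ℝ)) =
      volume.restrict ((fun p : Plane => (inner ℝ e' p : ℝ)) '' Ω) := by
  set f : Plane → ℝ := fun p => (inner ℝ e' p : ℝ) with hf
  have hT : MeasurableSet (topPart Ω e) := measurableSet_topPart hopen e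
  set φ : topPart Ω e → ℝ := (topPart Ω e).domRestrict f with hφ
  have hm : Measurable φ := (by fun_prop : Continuous fun p : topPart Ω e => f p).measurable
  ext S hS
  rw [Measure.map_apply hm hS, withDensity_apply _ (hm hS), Measure.restrict_apply hS]
  have h1 : f '' (Subtype.val '' (φ ⁻¹' S)) = S ∩ f '' Ω := by
    rw [← image_inner_topPart h hopen hbdd hconv, ← Set.image_comp]
    ext s
    constructor
    · rintro ⟨p, hp, rfl⟩
      exact ⟨hp, p, p.2, rfl⟩
    · rintro ⟨hs, p, hp, rfl⟩
      exact ⟨⟨p, hp⟩, hs, rfl⟩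
  rw [← h1, volume_image_inner_eq_lintegral h hopen hbdd hn (by simp) (hT.subtype_image (hm hS))]
  exact setLIntegral_subtype hT _ fun p : Plane => ENNReal.ofReal (inner ℝ e (n p))

theorem measurableEmbedding_inner_topPart (h : Orthonormal ℝ ![e', e]) (hopen : IsOpen Ω)
    (hn : ∀ p ∈ frontier Ω, IsOuterUnitNormal Ω p (n p)) :
    MeasurableEmbedding ((topPart Ω e).domRestrict fun p : Plane => (inner ℝ e' p : ℝ)) :=
  ContinuousOn.measurableEmbedding (measurableSet_topPart hopen e) (by fun_prop)
    (injOn_inner_topPart h hopen hn)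

theorem top_inner_eq_self (h : Orthonormal ℝ ![e', e]) (hopen : IsOpen Ω)
    (hbdd : Bornology.IsBounded Ω) (hconv : Convex ℝ Ω)
    (hn : ∀ p ∈ frontier Ω, IsOuterUnitNormal Ω p (n p)) {p : Plane} (hp : p ∈ topPart Ω e) :
    (inner ℝ e' p : ℝ) • e' + topHeight Ω e' e (inner ℝ e' p) • e = p := by
  have hs : (inner ℝ e' p : ℝ) ∈ (fun p : Plane => (inner ℝ e' p : ℝ)) '' Ω := by
    rw [← image_inner_topPart h hopen hbdd hconv]; exact ⟨p, hp, rfl⟩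
  refine injOn_inner_topPart h hopen hn (top_mem_topPart h hopen hbdd hconv hs) hp ?_
  simp only [inner_add_right, inner_smul_right, frame_inner h, frame_inner_self_left h, mul_one,
    mul_zero, add_zero]

/-- Integration of boundary values over the shadow of `Ω` amounts to integration over the top part
of the boundary against `⟪e, n⟫`. -/
theorem integral_top_eq_integral_topPart (h : Orthonormal ℝ ![e', e]) (hopen : IsOpen Ω)
    (hbdd : Bornology.IsBounded Ω) (hconv : Convex ℝ Ω)
    (hn : ∀ p ∈ frontier Ω, IsOuterUnitNormal Ω p (n p)) (g : Plane → ℝ) :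
    ∫ s in (fun p : Plane => (inner ℝ e' p : ℝ)) '' Ω, g (s • e' + topHeight Ω e' e s • e) =
      ∫ p in topPart Ω e, g p * inner ℝ e (n p) ∂(Measure.hausdorffMeasure 1) := by
  rw [← map_inner_withDensity_eq_restrict h hopen hbdd hconv hn,
    (measurableEmbedding_inner_topPart h hopen hn).integral_map,
    integral_withDensity_eq_integral_toReal_smul
      (measurable_inner_normal_right h hopen hn).ennreal_ofReal (by simp),
    ← integral_subtype_comap (measurableSet_topPart hopen e)]
  refine integral_congr_ae (Filter.Eventually.of_forall fun p => ?_)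
  simp only [Set.domRestrict_apply, top_inner_eq_self h hopen hbdd hconv hn p.2]
  rw [ENNReal.toReal_ofReal (inner_normal_pos_of_mem_topPart hopen hn p.2).le, smul_eq_mul,
    mul_comm]

theorem exists_bound_on_closure {g : Plane → ℝ} (hg : Continuous g)
    (hbdd : Bornology.IsBounded Ω) : ∃ M : ℝ, ∀ p ∈ closure Ω, ‖g p‖ ≤ M :=
  hbdd.isCompact_closure.exists_bound_of_continuousOn hg.continuousOn

theorem integrableOn_top (h : Orthonormal ℝ ![e', e]) (hopen : IsOpen Ω)
    (hbdd : Bornology.IsBounded Ω) (hconv : Convex ℝ Ω)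
    (hn : ∀ p ∈ frontier Ω, IsOuterUnitNormal Ω p (n p)) {g : Plane → ℝ} (hg : Continuous g) :
    IntegrableOn (fun s => g (s • e' + topHeight Ω e' e s • e))
      ((fun p : Plane => (inner ℝ e' p : ℝ)) '' Ω) := by
  have hmap := map_inner_withDensity_eq_restrict h hopen hbdd hconv hn
  have hfin : IsFiniteMeasure (((Measure.hausdorffMeasure 1 : Measure Plane).comap
      (Subtype.val : topPart Ω e → Plane)).withDensity
        fun p => ENNReal.ofReal (inner ℝ e (n p))) := by
    refine ⟨?_⟩
    rw [← Set.preimage_univ (f := (topPart Ω e).domRestrict fun p : Plane => (inner ℝ e' p : ℝ)),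
      ← (measurableEmbedding_inner_topPart h hopen hn).map_apply, hmap, Measure.restrict_apply_univ]
    exact ((innerSL ℝ e').lipschitz.isBounded_image hbdd).measure_lt_top
  obtain ⟨M, hM⟩ := exists_bound_on_closure hg hbdd
  rw [IntegrableOn, ← hmap, (measurableEmbedding_inner_topPart h hopen hn).integrable_map_iff]
  have heq : (fun s => g (s • e' + topHeight Ω e' e s • e)) ∘
      ((topPart Ω e).domRestrict fun p : Plane => (inner ℝ e' p : ℝ)) =
        fun p : topPart Ω e => g p := by
    ext p
    simp only [Function.comp_apply, Set.domRestrict_apply,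
      top_inner_eq_self h hopen hbdd hconv hn p.2]
  rw [heq]
  exact Integrable.of_bound (by fun_prop) M
    (Filter.Eventually.of_forall fun p => hM p (frontier_subset_closure p.2.1))

end Area

/-! ### The divergence theorem on a convex set -/

section Divergence

variable {Ω : Set Plane} {n : Plane → Plane} {e' e : Plane}

/-- Cartesian coordinates with respect to an orthonormal frame. -/
noncomputable def frameEquiv (h : Orthonormal ℝ ![e', e]) : ℝ × ℝ ≃ᵐ Plane :=
  (MeasurableEquiv.finTwoArrow (α := ℝ)).symm.trans
    ((MeasurableEquiv.toLp 2 (Fin 2 → ℝ)).trans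
      (frameBasis h).repr.symm.toHomeomorph.toMeasurableEquiv)

theorem frameEquiv_apply (h : Orthonormal ℝ ![e', e]) (s t : ℝ) :
    frameEquiv h (s, t) = s • e' + t • e := by
  have : frameEquiv h (s, t) = (frameBasis h).repr.symm (WithLp.toLp 2 ![s, t]) := rfl
  rw [this, ← (frameBasis h).sum_repr_symm, Fin.sum_univ_two, frameBasis_zero, frameBasis_one]
  rfl

theorem measurePreserving_frameEquiv (h : Orthonormal ℝ ![e', e]) :
    MeasurePreserving (frameEquiv h) volume volume := by
  have h1 := (volume_preserving_finTwoArrow ℝ).symm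
  have h2 : MeasurePreserving (MeasurableEquiv.toLp 2 (Fin 2 → ℝ)) volume volume :=
    (EuclideanSpace.volume_preserving_symm_measurableEquiv_toLp (Fin 2)).symm
  have h3 : MeasurePreserving (frameBasis h).repr.symm volume volume :=
    (frameBasis h).measurePreserving_repr_symm
  exact (h3.comp h2).comp h1

theorem neg_topHeight_neg : -topHeight Ω e' (-e) = fun s => sInf {t : ℝ | s • e' + t • e ∈ Ω} := by
  ext s
  rw [Pi.neg_apply, topHeight]
  have : {t : ℝ | s • e' + t • (-e) ∈ Ω} = -{t : ℝ | s • e' + t • e ∈ Ω} := by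
    ext t
    simp
  rw [this, Real.sSup_neg, neg_neg]

/-- The fundamental theorem of calculus on the sections of `Ω` along `e`. -/
theorem integral_section (h : Orthonormal ℝ ![e', e]) (hopen : IsOpen Ω)
    (hbdd : Bornology.IsBounded Ω) (hconv : Convex ℝ Ω) {g : Plane → ℝ} (hg : ContDiff ℝ 1 g) {s : ℝ}
    (hs : s ∈ (fun p : Plane => (inner ℝ e' p : ℝ)) '' Ω) :
    ∫ t in {t : ℝ | s • e' + t • e ∈ Ω}, fderiv ℝ g (s • e' + t • e) e =
      g (s • e' + topHeight Ω e' e s • e) - g (s • e' + topHeight Ω e' (-e) s • (-e)) := by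
  obtain ⟨hne, heq⟩ := section_eq_Ioo h hopen hbdd hconv hs
  have hinf : sInf {t : ℝ | s • e' + t • e ∈ Ω} = -topHeight Ω e' (-e) s :=
    (congrFun (neg_topHeight_neg (Ω := Ω) (e' := e') (e := e)) s).symm
  rw [hinf] at heq
  have hab : -topHeight Ω e' (-e) s < topHeight Ω e' e s := by
    rw [heq] at hne; exact Set.nonempty_Ioo.1 hne
  rw [heq, ← integral_Ioc_eq_integral_Ioo, ← intervalIntegral.integral_of_le hab.le, smul_neg,
    ← neg_smul]
  have hg' : Continuous (fderiv ℝ g) := hg.continuous_fderiv one_ne_zero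
  refine intervalIntegral.integral_eq_sub_of_hasDerivAt (f := fun t => g (s • e' + t • e))
    (fun t _ => ?_) (Continuous.intervalIntegrable (by fun_prop) _ _)
  have h1 : HasDerivAt (fun t : ℝ => s • e' + t • e) e t := by
    simpa using ((hasDerivAt_id t).smul_const e).const_add (s • e')
  exact ((hg.differentiable one_ne_zero _).hasFDerivAt).comp_hasDerivAt t h1

/-- Fubini along `e`: over each point of the shadow only the two ends of the section remain. -/
theorem integral_eq_integral_sub (h : Orthonormal ℝ ![e', e]) (hopen : IsOpen Ω)
    (hbdd : Bornology.IsBounded Ω) (hconv : Convex ℝ Ω) {g : Plane → ℝ} (hg : ContDiff ℝ 1 g) :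
    ∫ x in Ω, fderiv ℝ g x e = ∫ s in (fun p : Plane => (inner ℝ e' p : ℝ)) '' Ω,
      (g (s • e' + topHeight Ω e' e s • e) - g (s • e' + topHeight Ω e' (-e) s • (-e))) := by
  have hg' : Continuous (fderiv ℝ g) := hg.continuous_fderiv one_ne_zero
  have hint : IntegrableOn (fun x => fderiv ℝ g x e) Ω := by
    refine IntegrableOn.mono_set ?_ subset_closure
    exact ContinuousOn.integrableOn_compact hbdd.isCompact_closure (by fun_prop)
  have hproj : ∀ s t : ℝ, (inner ℝ e' (s • e' + t • e) : ℝ) = s := fun s t => by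
    rw [inner_add_right, inner_smul_right, inner_smul_right, frame_inner h,
      frame_inner_self_left h]
    ring
  have hSm : MeasurableSet ((fun p : Plane => (inner ℝ e' p : ℝ)) '' Ω) :=
    ((hconv.linear_image (innerSL ℝ e').toLinearMap).ordConnected).measurableSet
  have hi : Integrable (fun z => (Ω.indicator fun x => fderiv ℝ g x e) (frameEquiv h z))
      (volume : Measure (ℝ × ℝ)) :=
    (measurePreserving_frameEquiv h).integrable_comp_emb (frameEquiv h).measurableEmbedding |>.2
      (hint.integrable_indicator hopen.measurableSet)
  rw [← integral_indicator hopen.measurableSet,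
    ← (measurePreserving_frameEquiv h).integral_comp (frameEquiv h).measurableEmbedding,
    Measure.volume_eq_prod, integral_prod _ hi, ← integral_indicator hSm]
  refine integral_congr_ae (Filter.Eventually.of_forall fun s => ?_)
  simp only [frameEquiv_apply]
  by_cases hs : s ∈ (fun p : Plane => (inner ℝ e' p : ℝ)) '' Ω
  · have hm : MeasurableSet {t : ℝ | s • e' + t • e ∈ Ω} :=
      (hopen.preimage (f := fun t : ℝ => s • e' + t • e) (by fun_prop)).measurableSet
    rw [Set.indicator_of_mem hs, ← integral_section h hopen hbdd hconv hg hs,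
      ← integral_indicator hm]
    rfl
  · rw [Set.indicator_of_notMem hs]
    refine integral_eq_zero_of_ae (Filter.Eventually.of_forall fun t => ?_)
    exact Set.indicator_of_notMem (fun ht => hs ⟨_, ht, hproj s t⟩) _

theorem integrableOn_mul_inner_normal_topPart (h : Orthonormal ℝ ![e', e]) (hopen : IsOpen Ω)
    (hbdd : Bornology.IsBounded Ω)
    (hn : ∀ p ∈ frontier Ω, IsOuterUnitNormal Ω p (n p)) {g : Plane → ℝ} (hg : Continuous g) :
    IntegrableOn (fun p => g p * inner ℝ e (n p)) (topPart Ω e) (Measure.hausdorffMeasure 1) := by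
  have hT := measurableSet_topPart hopen e
  obtain ⟨M, hM⟩ := exists_bound_on_closure hg hbdd
  refine IntegrableOn.of_bound ((measure_mono Set.inter_subset_left).trans_lt
    (hausdorffMeasure_frontier_lt_top hbdd hn)) ?_ M ?_
  · have h1 : AEMeasurable (fun p => (inner ℝ e (n p) : ℝ))
        ((Measure.hausdorffMeasure 1 : Measure Plane).restrict (topPart Ω e)) :=
      aemeasurable_restrict_of_measurable_subtype hT (measurable_inner_normal_right h hopen hn)
    exact hg.aestronglyMeasurable.mul h1.aestronglyMeasurable
  · refine (ae_restrict_iff' hT).2 (Filter.Eventually.of_forall fun p hp => ?_)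
    have h2 : ‖(inner ℝ e (n p) : ℝ)‖ ≤ 1 := by
      have := norm_inner_le_norm (𝕜 := ℝ) e (n p)
      rwa [(hn p hp.1).1, (orthonormal_frame_iff.1 h).2.1, one_mul] at this
    rw [norm_mul]
    exact (mul_le_of_le_one_right (norm_nonneg _) h2).trans
      (hM p (frontier_subset_closure hp.1))

/-- The divergence theorem for the field `g • e` on a bounded open convex set of the plane. -/
theorem integral_fderiv_eq_integral_frontier (h : Orthonormal ℝ ![e', e]) (hopen : IsOpen Ω)
    (hne : Ω.Nonempty) (hbdd : Bornology.IsBounded Ω) (hconv : Convex ℝ Ω)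
    (hn : ∀ p ∈ frontier Ω, IsOuterUnitNormal Ω p (n p)) {g : Plane → ℝ} (hg : ContDiff ℝ 1 g) :
    IntegrableOn (fun p => g p * inner ℝ e (n p)) (frontier Ω) (Measure.hausdorffMeasure 1) ∧
    ∫ x in Ω, fderiv ℝ g x e =
      ∫ p in frontier Ω, g p * inner ℝ e (n p) ∂(Measure.hausdorffMeasure 1) := by
  have h' := frame_neg h
  have htop := integrableOn_mul_inner_normal_topPart h hopen hbdd hn hg.continuous
  have hbot : IntegrableOn (fun p => g p * inner ℝ e (n p)) (topPart Ω (-e))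
      (Measure.hausdorffMeasure 1) := by
    have := (integrableOn_mul_inner_normal_topPart h' hopen hbdd hn hg.continuous).neg
    refine this.congr_fun (fun p _ => ?_) (measurableSet_topPart hopen _)
    simp [inner_neg_left]
  have hsub : topPart Ω e ∪ topPart Ω (-e) ⊆ frontier Ω :=
    Set.union_subset Set.inter_subset_left Set.inter_subset_left
  have hdisj : Disjoint (topPart Ω e) (topPart Ω (-e)) := by
    refine Set.disjoint_left.2 fun p hp hp' => ?_
    have h1 := inner_normal_pos_of_mem_topPart hopen hn hp
    have h2 := inner_normal_pos_of_mem_topPart hopen hn hp'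
    rw [inner_neg_left] at h2
    linarith
  have hzero : ∀ᵐ p ∂(Measure.hausdorffMeasure 1 : Measure Plane),
      p ∈ frontier Ω \ (topPart Ω e ∪ topPart Ω (-e)) → g p * inner ℝ e (n p) = 0 := by
    have hnull : (Measure.hausdorffMeasure 1 : Measure Plane)
        (({p ∈ frontier Ω | 0 < (inner ℝ e (n p) : ℝ)} \ topPart Ω e) ∪
          ({p ∈ frontier Ω | 0 < (inner ℝ (-e) (n p) : ℝ)} \ topPart Ω (-e))) = 0 := by
      have : NullSingletonClass (Measure.hausdorffMeasure 1 : Measure Plane) :=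
        Measure.nullSingletonClass_hausdorff Plane one_pos
      exact ((finite_normal_pos_diff_topPart h hopen hne hbdd hconv hn).union
        (finite_normal_pos_diff_topPart h' hopen hne hbdd hconv hn)).measure_zero _
    filter_upwards [measure_eq_zero_iff_ae_notMem.1 hnull] with p hp hpf
    simp only [Set.mem_union, Set.mem_sdiff, Set.mem_ofPred_eq, inner_neg_left, not_or] at hp hpf
    obtain ⟨hpf, h1, h2⟩ := hpf
    have : (inner ℝ e (n p) : ℝ) = 0 := by
      by_contra hcon
      rcases lt_or_gt_of_ne hcon with hlt | hgt
      · exact hp.2 ⟨⟨hpf, by linarith⟩, h2⟩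
      · exact hp.1 ⟨⟨hpf, hgt⟩, h1⟩
    rw [this, mul_zero]
  have hf : NullMeasurableSet (frontier Ω) (Measure.hausdorffMeasure 1 : Measure Plane) :=
    isClosed_frontier.measurableSet.nullMeasurableSet
  refine ⟨(htop.union hbot).of_ae_sdiff_eq_zero hf hzero, ?_⟩
  rw [setIntegral_eq_of_subset_of_ae_sdiff_eq_zero hf hsub hzero,
    setIntegral_union hdisj (measurableSet_topPart hopen _) htop hbot,
    integral_eq_integral_sub h hopen hbdd hconv hg,
    integral_sub (integrableOn_top h hopen hbdd hconv hn hg.continuous)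
      (integrableOn_top h' hopen hbdd hconv hn hg.continuous),
    integral_top_eq_integral_topPart h hopen hbdd hconv hn,
    integral_top_eq_integral_topPart h' hopen hbdd hconv hn, sub_eq_add_neg, ← integral_neg]
  congr 2
  ext p
  rw [inner_neg_left, mul_neg, neg_neg]

end Divergence

/-! ### Kernels -/

/-- The convolution kernel `z ↦ γ(z, 0)`, set to zero on the circle of radius `δ`, where the
support condition leaves its value free. -/
noncomputable def profile (δ : ℝ) (γ : Plane → Plane → ℝ) (z : Plane) : ℝ :=
  (Metric.ball (0 : Plane) δ).indicator (fun z => γ z 0) z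

section Kernel

variable {δ σ : ℝ} {γ : Plane → Plane → ℝ}

theorem profile_nonneg (hγ : IsKernel δ σ γ) (z : Plane) : 0 ≤ profile δ γ z :=
  Set.indicator_nonneg (fun z _ => hγ.nonneg z 0) z

theorem profile_eq_zero {z : Plane} (hz : δ ≤ ‖z‖) : profile δ γ z = 0 :=
  Set.indicator_of_notMem (by simpa using hz) _

theorem profile_neg (hγ : IsKernel δ σ γ) (z : Plane) : profile δ γ (-z) = profile δ γ z := by
  obtain ⟨g, -, hg⟩ := hγ.radial
  simp [profile, Set.indicator, hg]

theorem ae_norm_ne (δ : ℝ) (hδ : δ ≠ 0) : ∀ᵐ z : Plane, ‖z‖ ≠ δ := by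
  have h := Measure.addHaar_sphere_of_ne_zero (volume : Measure Plane) (0 : Plane) hδ
  filter_upwards [measure_eq_zero_iff_ae_notMem.1 h] with z hz
  simpa using hz

theorem profile_ae_eq (hγ : IsKernel δ σ γ) : profile δ γ =ᵐ[volume] fun z => γ z 0 := by
  filter_upwards [ae_norm_ne δ hγ.pos.ne'] with z hz
  rcases lt_or_gt_of_ne hz with hlt | hgt
  · exact Set.indicator_of_mem (by simpa using hlt) _
  · rw [profile_eq_zero hgt.le, hγ.support z 0 (by simpa using hgt)]

theorem kernel_ae_eq_profile (hγ : IsKernel δ σ γ) (x : Plane) :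
    ∀ᵐ y : Plane, γ x y = profile δ γ (x - y) := by
  obtain ⟨g, -, hg⟩ := hγ.radial
  have hmp := Measure.measurePreserving_sub_left (volume : Measure Plane) x
  have h := hmp.quasiMeasurePreserving.ae
    (profile_ae_eq hγ)
  filter_upwards [h] with y hy
  rw [hy, hg, hg, sub_zero]

theorem integrable_profile (hγ : IsKernel δ σ γ) : Integrable (profile δ γ) := by
  obtain ⟨g, hgi, hg⟩ := hγ.radial
  have h1 : Integrable (fun z : Plane => (Set.Ioo 0 δ).indicator g ‖z‖) := by
    rw [integrable_fun_norm_addHaar volume, finrank_euclideanSpace_fin]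
    have h2 : IntegrableOn (fun r => r ^ (2 - 1) • g r) (Set.Ioo 0 δ) := by
      refine Integrable.bdd_mul (c := δ) hgi (by fun_prop) ?_
      refine (ae_restrict_iff' measurableSet_Ioo).2 (Filter.Eventually.of_forall fun r hr => ?_)
      rw [Nat.add_one_sub_one, pow_one, Real.norm_eq_abs, abs_of_pos hr.1]
      exact hr.2.le
    refine ((integrable_indicator_iff measurableSet_Ioo).2 h2).integrableOn.congr_fun
      (fun r _ => ?_) measurableSet_Ioi
    by_cases hr : r ∈ Set.Ioo 0 δ <;> simp [hr]
  refine h1.congr ?_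
  have h0 : ∀ᵐ z : Plane, z ≠ 0 := by simp [ae_iff]
  filter_upwards [h0] with z hz
  have hz' : 0 < ‖z‖ := norm_pos_iff.2 hz
  by_cases hzδ : ‖z‖ < δ
  · simp [profile, Set.indicator, hz', hzδ, hg]
  · simp [profile, Set.indicator, hzδ]

theorem integrable_mul_profile (hγ : IsKernel δ σ γ) {φ : Plane → ℝ} (hφ : Continuous φ) :
    Integrable fun z => φ z * profile δ γ z := by
  obtain ⟨M, hM⟩ := (isCompact_closedBall (0 : Plane) δ).exists_bound_of_continuousOn
    hφ.continuousOn
  refine ((integrable_profile hγ).const_mul M).mono'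
    (hφ.aestronglyMeasurable.mul (integrable_profile hγ).aestronglyMeasurable)
    (Filter.Eventually.of_forall fun z => ?_)
  rcases le_or_gt δ ‖z‖ with hz | hz
  · simp [profile_eq_zero hz]
  · rw [norm_mul, Real.norm_of_nonneg (profile_nonneg hγ z)]
    exact mul_le_mul_of_nonneg_right (hM z (by simpa using hz.le)) (profile_nonneg hγ z)

theorem integral_coord_mul_profile (hγ : IsKernel δ σ γ) (i j : Fin 2) :
    ∫ z : Plane, z i * z j * profile δ γ z = if i = j then 2 * σ else 0 := by
  have h := hγ.moment i j
  have h2 : ∫ z : Plane, z i * z j * profile δ γ z = ∫ z : Plane, z i * z j * γ z 0 := by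
    refine integral_congr_ae ?_
    filter_upwards [profile_ae_eq hγ] with z hz
    rw [hz]
  rw [h2]
  split_ifs at h ⊢ <;> linarith

theorem integral_norm_sq_mul_profile (hγ : IsKernel δ σ γ) :
    ∫ z : Plane, ‖z‖ ^ 2 * profile δ γ z = 4 * σ := by
  have h : ∀ z : Plane, ‖z‖ ^ 2 * profile δ γ z =
      z 0 * z 0 * profile δ γ z + z 1 * z 1 * profile δ γ z := by
    intro z
    rw [EuclideanSpace.real_norm_sq_eq, Fin.sum_univ_two]
    ring
  simp_rw [h]
  rw [integral_add (integrable_mul_profile hγ (by fun_prop))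
    (integrable_mul_profile hγ (by fun_prop)), integral_coord_mul_profile hγ,
    integral_coord_mul_profile hγ]
  simp only [if_true]
  ring

theorem sigma_nonneg (hγ : IsKernel δ σ γ) : 0 ≤ σ := by
  have h : 0 ≤ ∫ z : Plane, ‖z‖ ^ 2 * profile δ γ z :=
    integral_nonneg fun z => mul_nonneg (by positivity) (profile_nonneg hγ z)
  rw [integral_norm_sq_mul_profile hγ] at h
  linarith

theorem integral_linear_mul_profile (hγ : IsKernel δ σ γ) (L : Plane →L[ℝ] ℝ) :
    ∫ z : Plane, L z * profile δ γ z = 0 := by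
  have h := integral_neg_eq_self (fun z : Plane => L z * profile δ γ z) volume
  simp only [map_neg, profile_neg hγ, neg_mul] at h
  rw [integral_neg] at h
  linarith

/-- Isotropy of the second moment: a quadratic form integrates to `2σ` times its trace. -/
theorem integral_bilinear_mul_profile (hγ : IsKernel δ σ γ) (B : Plane →L[ℝ] Plane →L[ℝ] ℝ) :
    ∫ z : Plane, B z z * profile δ γ z =
      2 * σ * ∑ i, B (EuclideanSpace.single i 1) (EuclideanSpace.single i 1) := by
  have h : ∀ z : Plane, B z z * profile δ γ z = ∑ i, ∑ j,
      B (EuclideanSpace.single i 1) (EuclideanSpace.single j 1) *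
        (z i * z j * profile δ γ z) := by
    intro z
    have hz : z = ∑ i, z i • EuclideanSpace.single i (1 : ℝ) := by
      conv_lhs => rw [← (EuclideanSpace.basisFun (Fin 2) ℝ).sum_repr z]
      simp
    have hB : B z z = B (∑ i, z i • EuclideanSpace.single i (1 : ℝ))
        (∑ i, z i • EuclideanSpace.single i (1 : ℝ)) := by rw [← hz]
    rw [hB]
    simp only [map_add, map_smul, add_apply, smul_apply, smul_eq_mul, Fin.sum_univ_two]
    ring
  have hI : ∀ i j : Fin 2, Integrable fun z : Plane =>
      B (EuclideanSpace.single i 1) (EuclideanSpace.single j 1) * (z i * z j * profile δ γ z) :=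
    fun i j => (integrable_mul_profile hγ (by fun_prop)).const_mul _
  calc ∫ z : Plane, B z z * profile δ γ z
      = ∑ i, ∑ j, ∫ z : Plane, B (EuclideanSpace.single i 1) (EuclideanSpace.single j 1) *
          (z i * z j * profile δ γ z) := by
        simp_rw [h]
        rw [integral_finsetSum _ fun i _ => integrable_finsetSum _ fun j _ => hI i j]
        exact Finset.sum_congr rfl fun i _ => integral_finsetSum _ fun j _ => hI i j
    _ = _ := by
        simp_rw [integral_const_mul, integral_coord_mul_profile hγ]
        simp [mul_comm, mul_add]

end Kernel

/-! ### Symmetrized nonlocal energy -/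

section Field

variable {Ω : Set Plane} {f : Plane → Plane →L[ℝ] ℝ} {M : ℝ}

theorem norm_sub_le_of_fderiv_le (hf : ContDiff ℝ 1 f) (hM : ∀ x, ‖fderiv ℝ f x‖ ≤ M)
    (x y : Plane) : ‖f x - f y‖ ≤ M * ‖x - y‖ :=
  convex_univ.norm_image_sub_le_of_norm_hasFDerivWithin_le
    (fun z _ => (hf.differentiable one_ne_zero z).hasFDerivAt.hasFDerivWithinAt)
    (fun z _ => hM z) (Set.mem_univ y) (Set.mem_univ x)

theorem abs_sub_apply_le (hf : ContDiff ℝ 1 f) (hM : ∀ x, ‖fderiv ℝ f x‖ ≤ M)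
    (x y z : Plane) (hz : x - y = z) : |(f x - f y) z| ≤ M * ‖z‖ ^ 2 := by
  calc |(f x - f y) z| ≤ ‖f x - f y‖ * ‖z‖ := (f x - f y).le_opNorm z
    _ ≤ (M * ‖x - y‖) * ‖z‖ := by gcongr; exact norm_sub_le_of_fderiv_le hf hM x y
    _ = M * ‖z‖ ^ 2 := by rw [hz]; ring

/-- Translating a bounded open set inside its `δ`-neighbourhood changes an integral over it by at
most the bound of the integrand times twice the area of the outer layer. -/
theorem abs_integral_translate_sub_le (hopen : IsOpen Ω) (hbdd : Bornology.IsBounded Ω)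
    {φ : Plane → ℝ} (hφ : Continuous φ) {K δ : ℝ} (hK : ∀ x, |φ x| ≤ K) {w : Plane}
    (hw : ‖w‖ < δ) :
    |(∫ y in Ω, φ (y + w)) - ∫ y in Ω, φ y| ≤
      2 * (K * volume.real (Metric.thickening δ Ω \ Ω)) := by
  set A := Metric.thickening δ Ω
  have hA : MeasurableSet A := Metric.isOpen_thickening.measurableSet
  have hAfin : volume A ≠ ∞ := hbdd.thickening.measure_lt_top.ne
  have hδ : 0 < δ := (norm_nonneg w).trans_lt hw
  have hΩA : Ω ⊆ A := Metric.self_subset_thickening hδ Ω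
  set Ω' : Set Plane := (fun y => y - w) ⁻¹' Ω
  have hΩ'open : IsOpen Ω' := hopen.preimage (by fun_prop)
  have hΩ'A : Ω' ⊆ A := by
    intro y hy
    refine Metric.mem_thickening_iff.2 ⟨y - w, hy, ?_⟩
    simpa [dist_eq_norm] using hw
  have hmp : MeasurePreserving (fun y : Plane => y + w) volume volume :=
    measurePreserving_add_right volume w
  have htrans : ∫ y in Ω, φ (y + w) = ∫ y in Ω', φ y := by
    rw [← hmp.setIntegral_preimage_emb (MeasurableEquiv.addRight w).measurableEmbedding φ Ω']
    congr 2
    ext y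
    simp [Ω']
  have hvol : volume.real Ω' = volume.real Ω := by
    have := hmp.measure_preimage hΩ'open.measurableSet.nullMeasurableSet
    rw [measureReal_def, measureReal_def, ← this]
    congr 2
    ext y
    simp [Ω']
  have hint : IntegrableOn φ A := by
    refine IntegrableOn.of_bound hbdd.thickening.measure_lt_top hφ.aestronglyMeasurable K
      (Filter.Eventually.of_forall hK)
  have hdiff : ∀ S : Set Plane, MeasurableSet S → S ⊆ A → volume.real S = volume.real Ω →
      |(∫ y in A, φ y) - ∫ y in S, φ y| ≤ K * volume.real (A \ Ω) := by
    intro S hS hSA hSv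
    rw [← setIntegral_sdiff hS hint hSA]
    refine (norm_setIntegral_le_of_norm_le_const (f := φ) (C := K)
      ((measure_mono Set.sdiff_subset).trans_lt hAfin.lt_top) fun x _ => hK x).trans_eq ?_
    rw [measureReal_sdiff hSA hS hAfin, hSv, ← measureReal_sdiff hΩA hopen.measurableSet hAfin]
  have h1 := hdiff Ω hopen.measurableSet hΩA rfl
  have h2 := hdiff Ω' hΩ'open.measurableSet hΩ'A hvol
  rw [htrans]
  rw [abs_le] at *
  constructor <;> linarith [h1.1, h1.2, h2.1, h2.2]

/-- The increments of a field over `Ω` agree with its derivative up to the area of the outer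
layer: the remainder is bounded by translating `Ω` instead of differentiating again. -/
theorem abs_integral_increment_sub_le (hopen : IsOpen Ω) (hbdd : Bornology.IsBounded Ω)
    (hf : ContDiff ℝ 1 f) (hM : ∀ x, ‖fderiv ℝ f x‖ ≤ M) {δ : ℝ} {z : Plane} (hz : ‖z‖ < δ) :
    |(∫ y in Ω, (f (y + z) - f y) z) - ∫ y in Ω, fderiv ℝ f y z z| ≤
      2 * (M * ‖z‖ ^ 2 * volume.real (Metric.thickening δ Ω \ Ω)) := by
  have hf' : Continuous (fderiv ℝ f) := hf.continuous_fderiv one_ne_zero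
  set φ : Plane → ℝ := fun y => fderiv ℝ f y z z with hφ
  have hφc : Continuous φ := by fun_prop
  have hφb : ∀ y, |φ y| ≤ M * ‖z‖ ^ 2 := fun y => by
    calc |fderiv ℝ f y z z| ≤ ‖fderiv ℝ f y‖ * ‖z‖ * ‖z‖ := (fderiv ℝ f y).le_opNorm₂ z z
      _ ≤ M * ‖z‖ * ‖z‖ := by gcongr; exact hM y
      _ = _ := by ring
  have hinc : ∀ y, (f (y + z) - f y) z = ∫ t in (0 : ℝ)..1, φ (y + t • z) := by
    intro y
    rw [intervalIntegral.integral_eq_sub_of_hasDerivAt (f := fun t => f (y + t • z) z)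
      (fun t _ => ?_) (Continuous.intervalIntegrable (by fun_prop) _ _)]
    · simp
    · have h1 : HasDerivAt (fun t : ℝ => y + t • z) z t := by
        simpa using ((hasDerivAt_id t).smul_const z).const_add y
      have h2 := ((hf.differentiable one_ne_zero _).hasFDerivAt).comp_hasDerivAt t h1
      exact ((ContinuousLinearMap.apply ℝ ℝ z).hasFDerivAt.comp_hasDerivAt t h2)
  have hfin : IsFiniteMeasure (volume.restrict Ω) := ⟨by simpa using hbdd.measure_lt_top⟩
  have hswap : ∫ y in Ω, (f (y + z) - f y) z =
      ∫ t in (0 : ℝ)..1, ∫ y in Ω, φ (y + t • z) := by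
    simp_rw [hinc, intervalIntegral.integral_of_le zero_le_one]
    refine integral_integral_swap ?_
    refine Integrable.of_bound (C := M * ‖z‖ ^ 2) ?_ (Filter.Eventually.of_forall fun p => hφb _)
    exact (by unfold Function.uncurry; fun_prop : Continuous _).aestronglyMeasurable
  have hcont : Continuous fun t : ℝ => ∫ y in Ω, φ (y + t • z) :=
    continuous_of_dominated (bound := fun _ => M * ‖z‖ ^ 2)
      (fun t => by fun_prop) (fun t => Filter.Eventually.of_forall fun y => hφb _)
      (integrable_const _) (Filter.Eventually.of_forall fun y => by fun_prop)
  have hconst : ∫ y in Ω, φ y = ∫ t in (0 : ℝ)..1, ∫ y in Ω, φ y := by simp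
  rw [hswap, hconst, ← intervalIntegral.integral_sub (hcont.intervalIntegrable _ _) (by simp)]
  have hb := intervalIntegral.norm_integral_le_of_norm_le_const (a := 0) (b := 1)
    (f := fun t : ℝ => (∫ y in Ω, φ (y + t • z)) - ∫ y in Ω, φ y)
    (C := 2 * (M * ‖z‖ ^ 2 * volume.real (Metric.thickening δ Ω \ Ω))) fun t ht => ?_
  · simpa using hb
  · rw [Set.uIoc_of_le zero_le_one] at ht
    refine abs_integral_translate_sub_le hopen hbdd hφc hφb ?_
    rw [norm_smul, Real.norm_of_nonneg ht.1.le]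
    exact (mul_le_of_le_one_left (norm_nonneg z) ht.2).trans_lt hz

/-- For a fixed displacement `z`, the increments of `f` over the pairs `y`, `y + z` in the
neighbourhood of `Ω` amount to the derivative of `f` over `Ω`. -/
theorem abs_integral_pairs_sub_le (hopen : IsOpen Ω) (hbdd : Bornology.IsBounded Ω)
    (hf : ContDiff ℝ 1 f) (hM : ∀ x, ‖fderiv ℝ f x‖ ≤ M) {δ : ℝ} {z : Plane} (hz : ‖z‖ < δ) :
    |(∫ y in Metric.thickening δ Ω,
        (Metric.thickening δ Ω).indicator (fun x => (f x - f (x - z)) z) (y + z))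
        - ∫ y in Ω, fderiv ℝ f y z z| ≤
      3 * (M * ‖z‖ ^ 2 * volume.real (Metric.thickening δ Ω \ Ω)) := by
  set A := Metric.thickening δ Ω with hAdef
  have hA : MeasurableSet A := Metric.isOpen_thickening.measurableSet
  have hAfin : volume A < ∞ := hbdd.thickening.measure_lt_top
  have hΩA : Ω ⊆ A := Metric.self_subset_thickening ((norm_nonneg z).trans_lt hz) Ω
  set ψ : Plane → ℝ := fun y => A.indicator (fun x => (f x - f (x - z)) z) (y + z) with hψ
  have hfc := hf.continuous
  have hψb : ∀ y, |ψ y| ≤ M * ‖z‖ ^ 2 := fun y => by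
    rw [hψ]
    by_cases hy : y + z ∈ A
    · simp only [Set.indicator_of_mem hy]
      exact abs_sub_apply_le hf hM _ _ _ (by abel)
    · simp only [Set.indicator_of_notMem hy, abs_zero]
      have : 0 ≤ M := (norm_nonneg (fderiv ℝ f 0)).trans (hM 0)
      positivity
  have hψm : AEStronglyMeasurable ψ (volume.restrict A) := by
    refine Measurable.aestronglyMeasurable ?_
    refine Measurable.comp (Measurable.indicator ?_ hA) (measurable_add_const z)
    exact (by fun_prop : Continuous fun x => (f x - f (x - z)) z).measurable
  have hψi : IntegrableOn ψ A :=
    IntegrableOn.of_bound hAfin hψm (M * ‖z‖ ^ 2) (Filter.Eventually.of_forall hψb)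
  have hψΩ : ∫ y in Ω, ψ y = ∫ y in Ω, (f (y + z) - f y) z := by
    refine setIntegral_congr_fun hopen.measurableSet fun y hy => ?_
    have hyz : y + z ∈ A := Metric.mem_thickening_iff.2 ⟨y, hy, by simpa [dist_eq_norm] using hz⟩
    simp only [hψ, Set.indicator_of_mem hyz, add_sub_cancel_right]
  have h1 : |(∫ y in A, ψ y) - ∫ y in Ω, ψ y| ≤ M * ‖z‖ ^ 2 * volume.real (A \ Ω) := by
    rw [← setIntegral_sdiff hopen.measurableSet hψi hΩA]
    exact norm_setIntegral_le_of_norm_le_const (f := ψ) (C := M * ‖z‖ ^ 2)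
      ((measure_mono Set.sdiff_subset).trans_lt hAfin) fun x _ => hψb x
  have h2 := abs_integral_increment_sub_le hopen hbdd hf hM hz
  rw [← hψΩ] at h2
  rw [abs_le] at *
  constructor <;> linarith [h1.1, h1.2, h2.1, h2.2]

end Field

theorem exists_clm_eq_integral {E F : Type*} [NormedAddCommGroup E] [NormedSpace ℝ E]
    [ProperSpace E] [MeasurableSpace E] [BorelSpace E] [NormedAddCommGroup F]
    [NormedSpace ℝ F] [CompleteSpace F] (μ : Measure E) [IsFiniteMeasureOnCompacts μ]
    {S : Set E} (hS : Bornology.IsBounded S) {g : E → E →L[ℝ] F} (hg : Continuous g) :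
    ∃ B : E →L[ℝ] F, ∀ z, B z = ∫ y in S, g y z ∂μ := by
  have hI : IntegrableOn g S μ :=
    (ContinuousOn.integrableOn_compact hS.isCompact_closure hg.continuousOn).mono_set
      subset_closure
  exact ⟨∫ y in S, g y ∂μ, fun z => ContinuousLinearMap.integral_apply hI z⟩

theorem exists_bilinear_eq_integral {E : Type*} [NormedAddCommGroup E] [NormedSpace ℝ E]
    [ProperSpace E] [MeasurableSpace E] [BorelSpace E] (μ : Measure E) [IsFiniteMeasureOnCompacts μ]
    {S : Set E} (hS : Bornology.IsBounded S) {g : E → E →L[ℝ] E →L[ℝ] ℝ} (hg : Continuous g) :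
    ∃ B : E →L[ℝ] E →L[ℝ] ℝ, ∀ z w, B z w = ∫ y in S, g y z w ∂μ := by
  obtain ⟨B, hB⟩ := exists_clm_eq_integral (F := E →L[ℝ] ℝ) μ hS hg
  refine ⟨B, fun z w => ?_⟩
  have hgz : Continuous fun y => g y z := by fun_prop
  rw [hB, ContinuousLinearMap.integral_apply]
  exact (ContinuousOn.integrableOn_compact hS.isCompact_closure hgz.continuousOn).mono_set
      subset_closure

section Energy

variable {Ω : Set Plane} {f : Plane → Plane →L[ℝ] ℝ} {M δ σ : ℝ} {γ : Plane → Plane → ℝ}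

/-- Continuous weights against the kernel are integrable over pairs of points of a bounded set. -/
theorem integrable_prod_mul_profile (hγ : IsKernel δ σ γ) {A : Set Plane} (hA : MeasurableSet A)
    (hAb : Bornology.IsBounded A) {φ : Plane × Plane → ℝ} (hφ : Continuous φ) :
    Integrable (fun p : Plane × Plane => φ p * profile δ γ (p.1 - p.2))
      ((volume.restrict A).prod (volume.restrict A)) := by
  have hfin : IsFiniteMeasure (volume.restrict A) := ⟨by simpa using hAb.measure_lt_top⟩
  have h1 : Integrable (fun p : Plane × Plane => profile δ γ (p.1 - p.2))
      ((volume : Measure Plane).prod (volume.restrict A)) := by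
    have := Integrable.convolution_integrand (ContinuousLinearMap.mul ℝ ℝ)
      (integrable_const (1 : ℝ) : Integrable (fun _ : Plane => (1 : ℝ)) (volume.restrict A))
      (integrable_profile hγ)
    simpa using this
  have h2 : Integrable (fun p : Plane × Plane => profile δ γ (p.1 - p.2))
      ((volume.restrict A).prod (volume.restrict A)) := by
    have h3 := Measure.prod_restrict (μ := (volume : Measure Plane)) (ν := volume.restrict A) A
      Set.univ
    rw [Measure.restrict_univ] at h3
    rw [h3]
    exact h1.mono_measure Measure.restrict_le_self
  obtain ⟨K, hK⟩ := (hAb.isCompact_closure.prod hAb.isCompact_closure).exists_bound_of_continuousOn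
    hφ.continuousOn
  refine h2.bdd_mul hφ.aestronglyMeasurable (c := K) ?_
  rw [Measure.prod_restrict]
  refine (ae_restrict_iff' (hA.prod hA)).2 (Filter.Eventually.of_forall fun p hp => hK p ?_)
  exact ⟨subset_closure hp.1, subset_closure hp.2⟩

/-- Over a symmetric domain of pairs, the first-order energy only sees increments of the field. -/
theorem two_mul_integral_eq (hγ : IsKernel δ σ γ) {A : Set Plane} (hA : MeasurableSet A)
    (hAb : Bornology.IsBounded A) (hf : Continuous f) :
    2 * ∫ x in A, ∫ y in A, f x (x - y) * profile δ γ (x - y) =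
      ∫ x in A, ∫ y in A, (f x - f y) (x - y) * profile δ γ (x - y) := by
  have h1 := integrable_prod_mul_profile hγ hA hAb
    (φ := fun p => f p.1 (p.1 - p.2)) (by fun_prop)
  have h2 := integrable_prod_mul_profile hγ hA hAb
    (φ := fun p => f p.2 (p.1 - p.2)) (by fun_prop)
  have hswap : ∫ x in A, ∫ y in A, f x (x - y) * profile δ γ (x - y) =
      -∫ x in A, ∫ y in A, f y (x - y) * profile δ γ (x - y) := by
    rw [integral_integral_swap h1, ← integral_neg]
    congr 1
    ext x
    rw [← integral_neg]
    congr 1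
    ext y
    rw [← neg_sub x y, map_neg, profile_neg hγ, neg_mul]
  calc 2 * ∫ x in A, ∫ y in A, f x (x - y) * profile δ γ (x - y)
      = (∫ x in A, ∫ y in A, f x (x - y) * profile δ γ (x - y))
        - ∫ x in A, ∫ y in A, f y (x - y) * profile δ γ (x - y) := by
        rw [two_mul]; nth_rewrite 2 [hswap]; ring
    _ = ∫ x in A, ∫ y in A, (f x (x - y) * profile δ γ (x - y)
        - f y (x - y) * profile δ γ (x - y)) := (integral_integral_sub h1 h2).symm
    _ = _ := by simp_rw [sub_apply, sub_mul]

/-- The symmetrized energy, with the displacement as outer variable. -/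
theorem integral_increments_eq (hγ : IsKernel δ σ γ) {A : Set Plane} (hA : MeasurableSet A)
    (hAb : Bornology.IsBounded A) (hf : ContDiff ℝ 1 f) (hM : ∀ x, ‖fderiv ℝ f x‖ ≤ M) :
    Integrable (fun z => ∫ y in A, A.indicator (fun x => (f x - f (x - z)) z) (y + z)
      * profile δ γ z) ∧
    ∫ x in A, ∫ y in A, (f x - f y) (x - y) * profile δ γ (x - y) =
      ∫ z, ∫ y in A, A.indicator (fun x => (f x - f (x - z)) z) (y + z) * profile δ γ z := by
  have hfc := hf.continuous
  have hM0 : 0 ≤ M := (norm_nonneg (fderiv ℝ f 0)).trans (hM 0)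
  have hfin : IsFiniteMeasure (volume.restrict A) := ⟨by simpa using hAb.measure_lt_top⟩
  have h1 := integrable_prod_mul_profile hγ hA hAb
    (φ := fun p => (f p.1 - f p.2) (p.1 - p.2)) (by fun_prop)
  have h2 : Integrable (fun p : Plane × Plane =>
      A.indicator (fun x => (f x - f (x - p.2)) p.2) (p.1 + p.2) * profile δ γ p.2)
      ((volume.restrict A).prod volume) := by
    have hdom : Integrable (fun p : Plane × Plane => (1 : ℝ) * (M * (‖p.2‖ ^ 2 * profile δ γ p.2)))
        ((volume.restrict A).prod volume) :=
      (integrable_const (1 : ℝ)).mul_prod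
        ((integrable_mul_profile hγ (φ := fun z : Plane => ‖z‖ ^ 2) (by fun_prop)).const_mul M)
    refine hdom.mono' ?_ (Filter.Eventually.of_forall fun p => ?_)
    · refine AEStronglyMeasurable.mul ?_ (integrable_profile hγ).aestronglyMeasurable.comp_snd
      have heq : (fun p : Plane × Plane =>
          A.indicator (fun x => (f x - f (x - p.2)) p.2) (p.1 + p.2)) =
          ((fun p : Plane × Plane => p.1 + p.2) ⁻¹' A).indicator
            fun p => (f (p.1 + p.2) - f p.1) p.2 := by
        ext p
        simp only [Set.indicator, add_sub_cancel_right]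
        rfl
      rw [heq]
      refine (Measurable.indicator ?_ (hA.preimage (by fun_prop))).aestronglyMeasurable
      exact (by fun_prop : Continuous fun p : Plane × Plane =>
        (f (p.1 + p.2) - f p.1) p.2).measurable
    · rw [norm_mul, Real.norm_of_nonneg (profile_nonneg hγ p.2), one_mul, ← mul_assoc]
      refine mul_le_mul_of_nonneg_right ?_ (profile_nonneg hγ p.2)
      by_cases hp : p.1 + p.2 ∈ A
      · rw [Set.indicator_of_mem hp]
        exact abs_sub_apply_le hf hM _ _ _ (by abel)
      · rw [Set.indicator_of_notMem hp, norm_zero]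
        positivity
  refine ⟨h2.integral_prod_right, ?_⟩
  rw [integral_integral_swap h1]
  refine Eq.trans ?_ (integral_integral_swap (f := fun y z =>
    A.indicator (fun x => (f x - f (x - z)) z) (y + z) * profile δ γ z) h2)
  congr 1
  ext y
  rw [← integral_indicator hA, ← integral_add_left_eq_self _ y]
  congr 1
  ext z
  by_cases hz : y + z ∈ A <;> simp [Set.indicator, hz]

/-- The symmetrized energy over the neighbourhood of `Ω` is `2σ` times the integral of the
divergence, up to the area of the outer layer. -/
theorem abs_integral_increments_sub_divergence_le (hopen : IsOpen Ω)
    (hbdd : Bornology.IsBounded Ω) (hf : ContDiff ℝ 1 f) (hM : ∀ x, ‖fderiv ℝ f x‖ ≤ M)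
    (hγ : IsKernel δ σ γ) :
    |(∫ x in Metric.thickening δ Ω, ∫ y in Metric.thickening δ Ω,
        (f x - f y) (x - y) * profile δ γ (x - y))
      - 2 * σ * ∑ i, ∫ y in Ω, fderiv ℝ f y (EuclideanSpace.single i 1)
          (EuclideanSpace.single i 1)| ≤
      12 * M * σ * volume.real (Metric.thickening δ Ω \ Ω) := by
  set A := Metric.thickening δ Ω with hAdef
  set V := volume.real (A \ Ω)
  have hA : MeasurableSet A := Metric.isOpen_thickening.measurableSet
  have hf' : Continuous (fderiv ℝ f) := hf.continuous_fderiv one_ne_zero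
  obtain ⟨hint, heq⟩ := integral_increments_eq hγ hA hbdd.thickening hf hM
  obtain ⟨B, hBapp⟩ := exists_bilinear_eq_integral volume hbdd hf'
  have hBi : Integrable fun z : Plane => B z z * profile δ γ z :=
    integrable_mul_profile hγ (φ := fun z => B z z) (by fun_prop)
  simp_rw [← hBapp]
  rw [heq, ← integral_bilinear_mul_profile hγ B, ← integral_sub hint hBi]
  have hbound : Integrable fun z : Plane => 3 * M * V * (‖z‖ ^ 2 * profile δ γ z) :=
    (integrable_mul_profile hγ (by fun_prop)).const_mul _
  refine (norm_integral_le_of_norm_le (G := ℝ) hbound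
    (Filter.Eventually.of_forall fun z => ?_)).trans_eq ?_
  · rw [integral_mul_const, ← sub_mul, norm_mul, Real.norm_of_nonneg (profile_nonneg hγ z),
      ← mul_assoc]
    rcases le_or_gt δ ‖z‖ with hz | hz
    · simp [profile_eq_zero hz]
    · refine mul_le_mul_of_nonneg_right ?_ (profile_nonneg hγ z)
      rw [hBapp]
      refine (abs_integral_pairs_sub_le hopen hbdd hf hM hz).trans_eq ?_
      ring
  · rw [integral_const_mul, integral_norm_sq_mul_profile hγ]
    ring

/-- At points of the closure of `Ω` the neighbourhood contains the whole support of the kernel, so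
that the odd first-order part integrates to zero. -/
theorem integral_linear_eq_zero_of_mem_closure (hγ : IsKernel δ σ γ) (L : Plane →L[ℝ] ℝ)
    {x : Plane} (hx : x ∈ closure Ω) :
    ∫ y in Metric.thickening δ Ω, L (x - y) * profile δ γ (x - y) = 0 := by
  rw [setIntegral_eq_integral_of_forall_compl_eq_zero fun y hy => ?_]
  · rw [integral_sub_left_eq_self (fun z => L z * profile δ γ z) volume x]
    exact integral_linear_mul_profile hγ L
  · rw [profile_eq_zero, mul_zero]
    by_contra! hlt
    apply hy
    rw [← Metric.thickening_closure]
    exact Metric.mem_thickening_iff.2 ⟨x, hx, by rwa [dist_comm, dist_eq_norm]⟩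

/-- The divergence theorem for the field `f`, one coordinate direction at a time. -/
theorem sum_integral_fderiv_eq {n : Plane → Plane} (hopen : IsOpen Ω)
    (hne : Ω.Nonempty) (hbdd : Bornology.IsBounded Ω) (hconv : Convex ℝ Ω)
    (hn : ∀ p ∈ frontier Ω, IsOuterUnitNormal Ω p (n p)) (hf : ContDiff ℝ 1 f) :
    ∑ i, ∫ y in Ω, fderiv ℝ f y (EuclideanSpace.single i 1) (EuclideanSpace.single i 1) =
      ∫ p in frontier Ω, f p (n p) ∂(Measure.hausdorffMeasure 1) := by
  have h01 : Orthonormal ℝ ![EuclideanSpace.single 1 1, (EuclideanSpace.single 0 1 : Plane)] := by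
    rw [orthonormal_frame_iff]
    simp [EuclideanSpace.inner_single_left]
  have hframe : ∀ i : Fin 2, ∃ e' : Plane, Orthonormal ℝ ![e', EuclideanSpace.single i 1] := by
    intro i
    fin_cases i
    · exact ⟨_, h01⟩
    · exact ⟨_, frame_swap h01⟩
  have hdiv : ∀ i : Fin 2, IntegrableOn (fun p => f p (EuclideanSpace.single i 1) * n p i)
        (frontier Ω) (Measure.hausdorffMeasure 1) ∧
      ∫ y in Ω, fderiv ℝ f y (EuclideanSpace.single i 1) (EuclideanSpace.single i 1) =
        ∫ p in frontier Ω, f p (EuclideanSpace.single i 1) * n p i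
          ∂(Measure.hausdorffMeasure 1) := by
    intro i
    obtain ⟨e', h⟩ := hframe i
    have hg : ContDiff ℝ 1 fun p => f p (EuclideanSpace.single i 1) := by fun_prop
    have hd : ∀ y, fderiv ℝ (fun p => f p (EuclideanSpace.single i 1)) y
        (EuclideanSpace.single i 1) =
        fderiv ℝ f y (EuclideanSpace.single i 1) (EuclideanSpace.single i 1) := fun y => by
      rw [fderiv_clm_apply (hf.differentiable one_ne_zero y) (by fun_prop)]
      simp
    have := integral_fderiv_eq_integral_frontier h hopen hne hbdd hconv hn hg
    simpa only [hd, EuclideanSpace.inner_single_left, map_one, one_mul] using this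
  rw [Finset.sum_congr rfl fun i _ => (hdiv i).2, ← integral_finsetSum _ fun i _ => (hdiv i).1]
  congr 1
  ext p
  conv_rhs => rw [← (EuclideanSpace.basisFun (Fin 2) ℝ).sum_repr (n p), map_sum]
  simp [mul_comm]

end Energy

/-! ### The first-order expansion of the nonlocal Neumann operator -/

section Expansion

variable {Ω : Set Plane} {δ σ : ℝ} {γ : Plane → Plane → ℝ} {u v : Plane → ℝ}

theorem exists_bound_fderiv {F : Type*} [NormedAddCommGroup F] [NormedSpace ℝ F] {g : Plane → F}
    (hg : ContDiff ℝ 1 g) (hgs : HasCompactSupport g) : ∃ M : ℝ, ∀ x, ‖fderiv ℝ g x‖ ≤ M :=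
  (hg.continuous_fderiv one_ne_zero).bounded_above_of_compact_support (hgs.fderiv ℝ)

theorem abs_sub_sub_fderiv_le (hu : ContDiff ℝ 2 u) {M : ℝ}
    (hM : ∀ x, ‖fderiv ℝ (fderiv ℝ u) x‖ ≤ M) (x y : Plane) :
    |u x - u y - fderiv ℝ u x (x - y)| ≤ M * ‖x - y‖ ^ 2 := by
  have hD : ContDiff ℝ 1 (fderiv ℝ u) := hu.fderiv_right (by norm_num)
  have hM0 : 0 ≤ M := (norm_nonneg (fderiv ℝ (fderiv ℝ u) 0)).trans (hM 0)
  have hxy : y ∈ Metric.closedBall x ‖x - y‖ := by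
    rw [Metric.mem_closedBall, dist_comm, dist_eq_norm]
  have := (convex_closedBall x ‖x - y‖).norm_image_sub_le_of_norm_fderiv_le' (f := u)
    (φ := fderiv ℝ u x) (C := M * ‖x - y‖) (fun z _ => hu.differentiable two_ne_zero z)
    (fun z hz => ?_) hxy (Metric.mem_closedBall_self (norm_nonneg _))
  · rw [pow_two, ← mul_assoc]
    exact this
  · refine (norm_sub_le_of_fderiv_le hD hM z x).trans ?_
    rw [mem_closedBall_iff_norm] at hz
    gcongr

theorem integrable_mul_profile_sub (hγ : IsKernel δ σ γ) {φ : Plane → ℝ} (hφ : Continuous φ)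
    (x : Plane) : Integrable fun y => φ y * profile δ γ (x - y) := by
  have := (integrable_mul_profile hγ (φ := fun z => φ (x - z)) (by fun_prop)).comp_sub_left x
  simpa using this

/-- The nonlocal operator differs from its first-order part by the second moment of the kernel. -/
theorem abs_integral_sub_first_order_le (hγ : IsKernel δ σ γ) (hu : ContDiff ℝ 2 u) {M : ℝ}
    (hM : ∀ x, ‖fderiv ℝ (fderiv ℝ u) x‖ ≤ M) (A : Set Plane) (x : Plane) :
    |(∫ y in A, (u x - u y) * profile δ γ (x - y))
      - ∫ y in A, fderiv ℝ u x (x - y) * profile δ γ (x - y)| ≤ M * (4 * σ) := by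
  have huc := hu.continuous
  have hb : Integrable fun y : Plane => M * (‖x - y‖ ^ 2 * profile δ γ (x - y)) :=
    (integrable_mul_profile_sub hγ (φ := fun y => ‖x - y‖ ^ 2) (by fun_prop) x).const_mul M
  have hM0 : 0 ≤ M := (norm_nonneg (fderiv ℝ (fderiv ℝ u) 0)).trans (hM 0)
  rw [← integral_sub
    (integrable_mul_profile_sub hγ (φ := fun y => u x - u y) (by fun_prop) x).integrableOn
    (integrable_mul_profile_sub hγ (φ := fun y => fderiv ℝ u x (x - y))
      (by fun_prop) x).integrableOn]
  calc _ ≤ ∫ y in A, M * (‖x - y‖ ^ 2 * profile δ γ (x - y)) := by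
        refine norm_integral_le_of_norm_le (G := ℝ) hb.integrableOn
          (Filter.Eventually.of_forall fun y => ?_)
        rw [← sub_mul, norm_mul, Real.norm_of_nonneg (profile_nonneg hγ _), ← mul_assoc]
        exact mul_le_mul_of_nonneg_right (abs_sub_sub_fderiv_le hu hM x y) (profile_nonneg hγ _)
    _ ≤ ∫ y, M * (‖x - y‖ ^ 2 * profile δ γ (x - y)) :=
        setIntegral_le_integral hb (Filter.Eventually.of_forall fun y =>
          mul_nonneg hM0 (mul_nonneg (by positivity) (profile_nonneg hγ _)))
    _ = M * (4 * σ) := by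
        rw [integral_const_mul,
          integral_sub_left_eq_self (fun z => ‖z‖ ^ 2 * profile δ γ z) volume x,
          integral_norm_sq_mul_profile hγ]

/-- The asymptotic formula for globally smooth, compactly supported data. -/
theorem exists_bound_of_hasCompactSupport {n : Plane → Plane} (hopen : IsOpen Ω)
    (hne : Ω.Nonempty) (hbdd : Bornology.IsBounded Ω) (hconv : Convex ℝ Ω)
    (hn : ∀ p ∈ frontier Ω, IsOuterUnitNormal Ω p (n p)) (hu : ContDiff ℝ 2 u)
    (hus : HasCompactSupport u) (hv : ContDiff ℝ 1 v) (hvs : HasCompactSupport v) :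
    ∃ C : ℝ, ∀ δ σ : ℝ, δ ≤ 2 → ∀ γ : Plane → Plane → ℝ, IsKernel δ σ γ →
      |(∫ x in outerLayer Ω δ, (∫ y in outerPart Ω δ, (u x - u y) * profile δ γ (x - y)) * v x)
        - σ * boundaryPairing Ω n u v| ≤ σ * C * δ := by
  have hD : ContDiff ℝ 1 (fderiv ℝ u) := hu.fderiv_right (by norm_num)
  set f : Plane → Plane →L[ℝ] ℝ := fun x => v x • fderiv ℝ u x with hfdef
  have hf : ContDiff ℝ 1 f := hv.smul hD
  obtain ⟨M₁, hM₁⟩ := exists_bound_fderiv hD (hus.fderiv ℝ)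
  obtain ⟨M₂, hM₂⟩ := exists_bound_fderiv hf hvs.smul_right
  obtain ⟨K, hK⟩ := hv.continuous.bounded_above_of_compact_support hvs
  obtain ⟨C, hC0, hC⟩ := exists_volume_thickening_diff_le hopen hne hbdd hconv
  have hM₁0 : 0 ≤ M₁ := (norm_nonneg (fderiv ℝ (fderiv ℝ u) 0)).trans (hM₁ 0)
  have hM₂0 : 0 ≤ M₂ := (norm_nonneg (fderiv ℝ f 0)).trans (hM₂ 0)
  have hK0 : 0 ≤ K := (norm_nonneg _).trans (hK 0)
  refine ⟨(4 * M₁ * K + 6 * M₂) * C, fun δ σ hδ2 γ hγ => ?_⟩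
  have hσ := sigma_nonneg hγ
  have hvol := hC δ hγ.pos hδ2
  rw [outerLayer, outerPart_eq_thickening]
  set A := Metric.thickening δ Ω with hAdef
  have hA : MeasurableSet A := Metric.isOpen_thickening.measurableSet
  have hAb : Bornology.IsBounded A := hbdd.thickening
  have hlayer : MeasurableSet (A \ closure Ω) := hA.diff isClosed_closure.measurableSet
  have huc := hu.continuous
  have hvc := hv.continuous
  have hDc := hD.continuous
  have hlayer_le : volume.real (A \ closure Ω) ≤ volume.real (A \ Ω) :=
    measureReal_mono (Set.sdiff_subset_sdiff_right subset_closure)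
      ((measure_mono Set.sdiff_subset).trans_lt hAb.measure_lt_top).ne
  -- Second-order remainder of the Taylor expansion at the points of the layer.
  have hstep1 : |(∫ x in A \ closure Ω, (∫ y in A, (u x - u y) * profile δ γ (x - y)) * v x)
      - ∫ x in A \ closure Ω, (∫ y in A, fderiv ℝ u x (x - y) * profile δ γ (x - y)) * v x| ≤
      M₁ * (4 * σ) * K * volume.real (A \ Ω) := by
    have hi1 : IntegrableOn (fun x => (∫ y in A, (u x - u y) * profile δ γ (x - y)) * v x)
        (A \ closure Ω) := by
      have := (integrable_prod_mul_profile hγ hA hAb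
        (φ := fun p => v p.1 * (u p.1 - u p.2)) (by fun_prop)).integral_prod_left
      refine (IntegrableOn.mono_set this Set.sdiff_subset).congr_fun (fun x _ => ?_) hlayer
      simp only [mul_assoc, integral_const_mul]
      ring
    have hi2 : IntegrableOn (fun x => (∫ y in A, fderiv ℝ u x (x - y) * profile δ γ (x - y)) * v x)
        (A \ closure Ω) := by
      have := (integrable_prod_mul_profile hγ hA hAb
        (φ := fun p => v p.1 * fderiv ℝ u p.1 (p.1 - p.2)) (by fun_prop)).integral_prod_left
      refine (IntegrableOn.mono_set this Set.sdiff_subset).congr_fun (fun x _ => ?_) hlayer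
      simp only [mul_assoc, integral_const_mul]
      ring
    rw [← integral_sub hi1 hi2]
    refine (norm_setIntegral_le_of_norm_le_const (E := ℝ) (C := M₁ * (4 * σ) * K)
      ((measure_mono Set.sdiff_subset).trans_lt hAb.measure_lt_top) fun x _ => ?_).trans ?_
    · rw [← sub_mul, norm_mul]
      exact mul_le_mul (abs_integral_sub_first_order_le hγ hu hM₁ A x) (hK x) (norm_nonneg _)
        (by positivity)
    · exact mul_le_mul_of_nonneg_left hlayer_le (by positivity)
  -- The first-order part vanishes on the closure of `Ω`, so the layer may be filled up.
  have hstep2 : ∫ x in A \ closure Ω,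
      (∫ y in A, fderiv ℝ u x (x - y) * profile δ γ (x - y)) * v x =
      ∫ x in A, ∫ y in A, f x (x - y) * profile δ γ (x - y) := by
    have h1 : ∀ x, ∫ y in A, f x (x - y) * profile δ γ (x - y) =
        (∫ y in A, fderiv ℝ u x (x - y) * profile δ γ (x - y)) * v x := fun x => by
      simp only [hfdef, smul_apply, smul_eq_mul, mul_assoc, integral_const_mul]
      ring
    simp_rw [h1]
    refine (setIntegral_eq_of_subset_of_forall_sdiff_eq_zero hA Set.sdiff_subset
      fun x hx => ?_).symm
    have hxc : x ∈ closure Ω := by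
      by_contra hcon
      exact hx.2 ⟨hx.1, hcon⟩
    rw [integral_linear_eq_zero_of_mem_closure hγ _ hxc, zero_mul]
  have hstep3 := two_mul_integral_eq hγ hA hAb hf.continuous
  have hstep4 := abs_integral_increments_sub_divergence_le hopen hbdd hf hM₂ hγ
  have hstep5 : ∑ i, ∫ y in Ω, fderiv ℝ f y (EuclideanSpace.single i 1)
      (EuclideanSpace.single i 1) = boundaryPairing Ω n u v := by
    rw [sum_integral_fderiv_eq hopen hne hbdd hconv hn hf, boundaryPairing]
    simp only [hfdef, smul_apply, smul_eq_mul, mul_comm]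
  rw [← hAdef, ← hstep3, hstep5] at hstep4
  rw [hstep2] at hstep1
  have hfinal : σ * (4 * M₁ * K + 6 * M₂) * volume.real (A \ Ω) ≤
      σ * (4 * M₁ * K + 6 * M₂) * (C * δ) := by gcongr
  rw [abs_le] at *
  constructor <;> linarith [hstep1.1, hstep1.2, hstep4.1, hstep4.2]

end Expansion

/-! ### Localization near the boundary -/

section Localization

variable {Ω : Set Plane}

theorem frontier_subset_interior_boundaryLayer (hopen : IsOpen Ω) {δ₀ : ℝ} (hδ₀ : 0 < δ₀) :
    frontier Ω ⊆ interior (boundaryLayer Ω δ₀) := by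
  set U : Set Plane := outerPart Ω δ₀ ∩ (closure (innerPart Ω δ₀))ᶜ
  have hU : IsOpen U := isClosed_closure.isOpen_compl.inter isClosed_closure.isOpen_compl
  have hUsub : U ⊆ boundaryLayer Ω δ₀ := by
    rintro x ⟨hx1, hx2⟩
    by_cases hxΩ : x ∈ Ω
    · exact Or.inl (Or.inl ⟨hxΩ, hx2⟩)
    by_cases hxc : x ∈ closure Ω
    · exact Or.inl (Or.inr (by rw [hopen.frontier_eq]; exact ⟨hxc, hxΩ⟩))
    · exact Or.inr ⟨hx1, hxc⟩
  intro p hp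
  refine interior_maximal hUsub hU ⟨?_, fun hpc => ?_⟩
  · rw [outerPart_eq_thickening]
    exact Metric.closure_subset_thickening hδ₀ Ω (frontier_subset_closure hp)
  · obtain ⟨x, hx, hpx⟩ := Metric.mem_closure_iff.1 hpc δ₀ hδ₀
    rw [hopen.frontier_eq] at hp
    exact hp.2 (hx.2 hpx)

/-- A point of the outer layer of width `δ` lies within `δ` of the boundary. -/
theorem outerLayer_subset_thickening_frontier (hne : Ω.Nonempty) {δ : ℝ} :
    outerLayer Ω δ ⊆ Metric.thickening δ (frontier Ω) := by
  rintro x ⟨hx, hxc⟩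
  rw [outerPart_eq_thickening, Metric.mem_thickening_iff_infDist_lt hne] at hx
  have hxΩ : x ∈ Ωᶜ := fun h => hxc (subset_closure h)
  obtain ⟨y, hy, hxy⟩ := exists_mem_frontier_infDist_compl_eq_dist hxΩ
    (fun h => by rw [Set.compl_univ_iff] at h; exact hne.ne_empty h)
  rw [compl_compl] at hxy
  rw [frontier_compl] at hy
  exact Metric.mem_thickening_iff.2 ⟨y, hy, hxy ▸ hx⟩

theorem contDiff_mul_of_contDiffOn {U L : Set Plane} (hU : IsOpen U) (hL : IsCompact L)
    (hLU : L ⊆ U) {χ w : Plane → ℝ} {m : ℕ∞} (hχ : ContDiff ℝ m χ) (hχ0 : ∀ x ∉ L, χ x = 0)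
    (hw : ContDiffOn ℝ m w U) :
    ContDiff ℝ m (fun x => χ x * w x) ∧ HasCompactSupport (fun x => χ x * w x) := by
  refine ⟨contDiff_iff_contDiffAt.2 fun x => ?_,
    HasCompactSupport.intro hL fun x hx => by rw [hχ0 x hx, zero_mul]⟩
  by_cases hx : x ∈ U
  · exact hχ.contDiffAt.mul (hw.contDiffAt (hU.mem_nhds hx))
  · refine (contDiffAt_const (c := (0 : ℝ))).congr_of_eventuallyEq ?_
    filter_upwards [hL.isClosed.isOpen_compl.mem_nhds fun h => hx (hLU h)] with y hy
    rw [hχ0 y hy, zero_mul]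

end Localization

end NonlocalNeumann

open NonlocalNeumann in
theorem theorem6p3 (Ω : Set Plane) (hΩ_open : IsOpen Ω) (hΩ_ne : Ω.Nonempty)
    (hΩ_bdd : Bornology.IsBounded Ω) (hΩ_conv : Convex ℝ Ω)
    (hΩ : HasC2Boundary Ω ∨ IsConvexPolygon Ω)
    (n : Plane → Plane) (hn : ∀ p ∈ frontier Ω, IsOuterUnitNormal Ω p (n p))
    (δ₀ : ℝ) (hδ₀ : 0 < δ₀) (u v : Plane → ℝ)
    (hu : ContDiffOn ℝ 2 u (boundaryLayer Ω δ₀))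
    (hv : ContDiffOn ℝ 1 v (boundaryLayer Ω δ₀)) (σ : ℝ) :
    ∃ C δ₁ : ℝ, 0 < δ₁ ∧ ∀ δ : ℝ, 0 < δ → δ < δ₁ →
      ∀ γ : Plane → Plane → ℝ, IsKernel δ σ γ →
        |(∫ x in outerLayer Ω δ, outerNeumann Ω δ γ u x * v x)
            - σ * boundaryPairing Ω n u v| ≤ C * δ := by
  have hfc : IsCompact (frontier Ω) :=
    hΩ_bdd.isCompact_closure.of_isClosed_subset isClosed_frontier frontier_subset_closure
  obtain ⟨L, hL, hfL, hLU⟩ := exists_compact_between hfc isOpen_interior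
    (frontier_subset_interior_boundaryLayer hΩ_open hδ₀)
  obtain ⟨χ, hχ1, hχ0, -⟩ := exists_contMDiffMap_one_nhds_of_subset_interior
    (modelWithCornersSelf ℝ Plane) (n := ⊤) hfc.isClosed hfL
  have hχ : ContDiff ℝ ((⊤ : ℕ∞) : WithTop ℕ∞) χ := χ.contMDiff.contDiff
  obtain ⟨hu2, hus⟩ := contDiff_mul_of_contDiffOn isOpen_interior hL hLU (m := 2)
    (hχ.of_le (by exact_mod_cast le_top)) hχ0 (hu.mono interior_subset)
  obtain ⟨hv1, hvs⟩ := contDiff_mul_of_contDiffOn isOpen_interior hL hLU (m := 1)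
    (hχ.of_le (by exact_mod_cast le_top)) hχ0 (hv.mono interior_subset)
  -- On the `r`-neighbourhood of the boundary the cutoff is `1`; for `2 * δ < r` it contains all
  -- pairs `x`, `y` that enter the left-hand side.
  obtain ⟨W, hWo, hfW, hW⟩ := mem_nhdsSet_iff_exists.1 hχ1
  obtain ⟨r, hr, hrW⟩ := hfc.exists_thickening_subset_open hWo hfW
  have hone : ∀ x ∈ Metric.thickening r (frontier Ω), χ x = 1 := fun x hx => hW (hrW hx)
  obtain ⟨C, hC⟩ :=
    exists_bound_of_hasCompactSupport hΩ_open hΩ_ne hΩ_bdd hΩ_conv hn hu2 hus hv1 hvs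
  refine ⟨σ * C, min 2 (r / 2), by positivity, fun δ hδ hδ₁ γ hγ => ?_⟩
  have hδr : δ < r / 2 := hδ₁.trans_le (min_le_right _ _)
  have hmain := hC δ σ (hδ₁.le.trans (min_le_left _ _)) γ hγ
  have hpair : boundaryPairing Ω n (fun x => χ x * u x) (fun x => χ x * v x) =
      boundaryPairing Ω n u v := by
    refine setIntegral_congr_fun isClosed_frontier.measurableSet fun p hp => ?_
    have hnear : (fun x => χ x * u x) =ᶠ[nhds p] u := by
      filter_upwards [hWo.mem_nhds (hfW hp)] with x hx
      rw [hW hx, one_mul]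
    simp only [hnear.fderiv_eq]
    rw [hW (hfW hp), one_mul]
  have hlayer : MeasurableSet (outerLayer Ω δ) :=
    (isClosed_closure.isOpen_compl.measurableSet).diff isClosed_closure.measurableSet
  have hop : ∫ x in outerLayer Ω δ, outerNeumann Ω δ γ u x * v x =
      ∫ x in outerLayer Ω δ, (∫ y in outerPart Ω δ,
        (χ x * u x - χ y * u y) * profile δ γ (x - y)) * (χ x * v x) := by
    refine setIntegral_congr_fun hlayer fun x hx => ?_
    obtain ⟨p, hp, hxp⟩ := Metric.mem_thickening_iff.1
      (outerLayer_subset_thickening_frontier hΩ_ne hx)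
    have hx1 : χ x = 1 := hone x (Metric.mem_thickening_iff.2 ⟨p, hp, by linarith⟩)
    simp only [hx1, one_mul, outerNeumann]
    congr 1
    refine integral_congr_ae (ae_restrict_of_ae ?_)
    filter_upwards [kernel_ae_eq_profile hγ x] with y hy
    rw [hy]
    rcases le_or_gt δ ‖x - y‖ with hxy | hxy
    · rw [profile_eq_zero hxy, mul_zero, mul_zero]
    · have hy1 : χ y = 1 := by
        refine hone y (Metric.mem_thickening_iff.2 ⟨p, hp, ?_⟩)
        have h1 := dist_triangle y x p
        rw [dist_comm y x, dist_eq_norm x y] at h1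
        linarith
      rw [hy1, one_mul]
  rw [hop, ← hpair]
  exact hmain
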